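/- Let $h\ge 1$ and let $p_1,\dots,p_h$ be primes with $p_i\ne p_{i+1}$ for $1\le i<h$. The algebra $\mathbf D=\mathbf D[p_1,\dots,p_h]$ is the group $\mathbb Z_{p_1}\times\dots\times\mathbb Z_{p_h}$ together with the unary operations $e_j(x)=(0,\dots,0,x_j,0,\dots,0)$ for $1\le j\le h$ and $v_j(x)=(0,\dots,0,b_j(x_{j+1}),0,\dots,0)$ for $1\le j<h$ (nonzero at most in the $j$-th place), where $b_j(0)=0$ and $b_j(a)=1$ for $a\neq 0$. A circuit $\Gamma$ over $\mathbf D$ has input gates, constants from $\mathbf D$, and gates for the operations of $\mathbf D$, and it has two output gates; its size $|\Gamma|$ is the number of its gates (input gates included). The problem $\mathrm{CSat}(\mathbf D)$ asks, for a given $\Gamma$, whether some valuation of the input gates gives the same value at both output gates; $\mathrm{CEqv}(\mathbf D)$ asks whether all valuations do. A gate $\mathrm{MOD}^R_m$ (of unbounded fan-in) returns $1$ if the sum of its inputs modulo $m$ is in $R\subseteq\mathbb Z_m$, and $0$ otherwise. A $CC[p_1,\dots,p_h]$-circuit consists of $h$ levels, the gates of level $i$ being of the form $\mathrm{MOD}^R_{p_i}$;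 the output gate is on level $1$, the gates of level $i<h$ are fed by gates of level $i+1$, and those of level $h$ by the Boolean inputs. Its size is the number of its gates. The Strong Exponential Size Hypothesis (SESH) says: for all $h>1$ and all primes $p_1,\dots,p_h$ with $p_i\ne p_{i+1}$ there is a constant $c>0$ such that the size of $CC[p_1,\dots,p_h]$-circuits computing the $n$-ary conjunction $\mathrm{AND}_n$ is at least $\Omega(2^{c\,n^{1/(h-1)}})$. **Theorem.** Assume SESH. Then for all $h\ge1$ and all primes $p_1,\dots,p_h$ with $p_i\neq p_{i+1}$ for $1\le i<h$, there are deterministic algorithms (multi-stack Turing machines) that solve $\mathrm{CSat}(\mathbf D[p_1,\dots,p_h])$ and $\mathrm{CEqv}(\mathbf D[p_1,\dots,p_h])$ in time $O(2^{c\log^h|\Gamma|})$, where $\Gamma$ is the input circuit and the constant $c>0$ depends only on $p_1,\dots,p_h$. -/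

import Mathlib

/-! ### Sequences of primes -/

/-- `p₁, …, p_h` are primes and any two consecutive ones are different. -/
def AlternatingPrimes {h : ℕ} (p : Fin h → ℕ) : Prop :=
  (∀ i, (p i).Prime) ∧ ∀ i j : Fin h, (j : ℕ) = i + 1 → p i ≠ p j

/-! ### `CC[p₁, …, p_h]`-circuits and the Strong Exponential Size Hypothesis -/

/-- A `CC[p₁, …, p_h]`-circuit with `n` Boolean inputs. Its gates are arranged in `h` levels; the
gates of the `i`-th level are `MOD_{p_i}^R`-gates (of unbounded fan-in, where `R` may vary from gate
to gate). The output gate is on the first level, a gate on a level other than the last one is fed by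
gates of the next level, and the gates of the last level are fed by the inputs. The same source may
be wired to a gate several times. (Levels are numbered from `0` here.) -/
structure CCCircuit {h : ℕ} (p : Fin h → ℕ) (n : ℕ) where
  /-- the gates -/
  Gate : Type
  [fintypeGate : Fintype Gate]
  /-- the level of a gate -/
  level : Gate → Fin h
  /-- the set `R` of a `MOD^R`-gate -/
  accept : (g : Gate) → Set (ZMod (p (level g)))
  /-- the number of wires from the `i`-th input to the gate `g` -/
  inputWires : (g : Gate) → (i : Fin n) → ℕ
  /-- the number of wires from the gate `g'` to the gate `g` -/
  gateWires : (g g' : Gate) → ℕ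
  inputWires_level : ∀ g i, inputWires g i ≠ 0 → (level g : ℕ) + 1 = h
  gateWires_level : ∀ g g', gateWires g g' ≠ 0 → (level g' : ℕ) = level g + 1
  /-- the output gate -/
  output : Gate
  output_level : (level output : ℕ) = 0

namespace CCCircuit

attribute [instance] CCCircuit.fintypeGate

variable {h : ℕ} {p : Fin h → ℕ} {n : ℕ}

/-- The size of a circuit: the number of its gates. -/
def size (C : CCCircuit p n) : ℕ := Fintype.card C.Gate

open Classical in
/-- The value of a gate: a `MOD_{p_i}^R`-gate returns `1` if the number of `1`'s that it receives,
counted with multiplicity and taken modulo `p_i`, is in `R`, and `0` otherwise. -/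
noncomputable def value (C : CCCircuit p n) (x : Fin n → Bool) (g : C.Gate) : Bool :=
  decide (((∑ i, C.inputWires g i * (x i).toNat +
      ∑ g', (if _hw : C.gateWires g g' ≠ 0 then C.gateWires g g' * (C.value x g').toNat else 0) :
        ℕ) : ZMod (p (C.level g))) ∈ C.accept g)
termination_by h - (C.level g : ℕ)
decreasing_by
  have h1 := C.gateWires_level g g' _hw
  have _h2 := (C.level g').isLt
  omega

/-- The circuit computes the conjunction `AND_n` of its `n` inputs. -/
def ComputesAND (C : CCCircuit p n) : Prop :=
  ∀ x : Fin n → Bool, C.value x C.output = true ↔ ∀ i, x i = true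

end CCCircuit

/-- The Strong Exponential Size Hypothesis: for all `h > 1` and all primes
`p₁ ≠ p₂ ≠ … ≠ p_h`, the size of `CC[p₁, …, p_h]`-circuits that compute `AND_n` is
`Ω(2^{c n^{1/(h-1)}})` for some constant `c > 0`. -/
def SESH : Prop :=
  ∀ (h : ℕ) (p : Fin h → ℕ), 1 < h → AlternatingPrimes p →
    ∃ c : ℝ, 0 < c ∧ ∃ K : ℝ, 0 < K ∧ ∀ᶠ n : ℕ in Filter.atTop,
      ∀ C : CCCircuit p n, C.ComputesAND →
        K * (2 : ℝ) ^ (c * (n : ℝ) ^ (1 / ((h : ℝ) - 1))) ≤ (C.size : ℝ)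

/-! ### The algebra `D[p₁, …, p_h]` -/

/-- The universe of the algebra `D[p₁, …, p_h]`, with the group structure of
`ℤ_{p₁} × … × ℤ_{p_h}`. -/
abbrev DAlg {h : ℕ} (p : Fin h → ℕ) : Type := (i : Fin h) → ZMod (p i)

namespace DAlg

variable {h : ℕ} {p : Fin h → ℕ}

/-- The operation `e_j(x) = (0, …, 0, x_j, 0, …, 0)`. -/
def e (j : Fin h) (x : DAlg p) : DAlg p := Pi.single j (x j)

/-- The operation `v_j(x) = (0, …, 0, b_j(x_{j+1}), 0, …, 0)`, with `b_j(x_{j+1})` in the `j`-th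
place, where `b_j(0) = 0` and `b_j(a) = 1` for `a ≠ 0`. -/
def v (j : Fin (h - 1)) (x : DAlg p) : DAlg p :=
  Pi.single (⟨j, by omega⟩ : Fin h) (if x ⟨j + 1, by omega⟩ = 0 then 0 else 1)

end DAlg

/-! ### Circuits over `D[p₁, …, p_h]` -/

/-- The gates of circuits over `D[p₁, …, p_h]`: input gates, constants, and the basic operations
of the algebra. Gates of a circuit are numbered, and the arguments of a gate are given by numbers
of other gates. -/
inductive DGate {h : ℕ} (p : Fin h → ℕ) : Type
  | input : DGate p
  | const (d : DAlg p) : DGate p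
  | add (a b : ℕ) : DGate p
  | neg (a : ℕ) : DGate p
  | e (j : Fin h) (a : ℕ) : DGate p
  | v (j : Fin (h - 1)) (a : ℕ) : DGate p

namespace DGate

variable {h : ℕ} {p : Fin h → ℕ}

/-- The numbers of the gates that feed a gate. -/
def args : DGate p → List ℕ
  | input => []
  | const _ => []
  | add a b => [a, b]
  | neg a => [a]
  | e _ a => [a]
  | v _ a => [a]

/-- The value of a gate, given the list of the values of the previous gates, and the value `y` that
the gate gets from outside if it is an input gate. -/
def value (vals : List (DAlg p)) (y : DAlg p) : DGate p → DAlg p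
  | input => y
  | const d => d
  | add a b => vals.getD a 0 + vals.getD b 0
  | neg a => -vals.getD a 0
  | e j a => DAlg.e j (vals.getD a 0)
  | v j a => DAlg.v j (vals.getD a 0)

end DGate

/-- A circuit over `D[p₁, …, p_h]` with two output gates: a list of gates in which each gate is fed
by gates that stand before it. Each input gate is a separate variable. -/
structure DCircuit {h : ℕ} (p : Fin h → ℕ) where
  /-- the gates -/
  gates : List (DGate p)
  args_lt : ∀ (k : ℕ) (hk : k < gates.length), ∀ a ∈ (gates[k]).args, a < k
  /-- the first output gate -/
  out₁ : ℕ
  /-- the second output gate -/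
  out₂ : ℕ
  out₁_lt : out₁ < gates.length
  out₂_lt : out₂ < gates.length

namespace DCircuit

variable {h : ℕ} {p : Fin h → ℕ}

/-- The size of a circuit: the number of its gates, including input gates. -/
def size (Γ : DCircuit p) : ℕ := Γ.gates.length

/-- The list of the values of all gates, computed one after the other, when the `k`-th gate, if it
is an input gate, gets the value `x k`. -/
def values (Γ : DCircuit p) (x : ℕ → DAlg p) : List (DAlg p) :=
  Γ.gates.foldl (fun vals g => vals ++ [g.value vals (x vals.length)]) []

/-- The value of the `k`-th gate. -/
def value (Γ : DCircuit p) (x : ℕ → DAlg p) (k : ℕ) : DAlg p := (Γ.values x).getD k 0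

/-- Circuit satisfiability: some valuation of the input gates gives the same value at the two
output gates. -/
def CSat (Γ : DCircuit p) : Prop := ∃ x : ℕ → DAlg p, Γ.value x Γ.out₁ = Γ.value x Γ.out₂

/-- Circuit equivalence: every valuation of the input gates gives the same value at the two
output gates. -/
def CEqv (Γ : DCircuit p) : Prop := ∀ x : ℕ → DAlg p, Γ.value x Γ.out₁ = Γ.value x Γ.out₂

end DCircuit

/-! ### Circuits as inputs of Turing machines -/

/-- The finite alphabet in which circuits over `D[p₁, …, p_h]` are written down. -/
inductive DSym {h : ℕ} (p : Fin h → ℕ) : Type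
  | input : DSym p
  | const (d : DAlg p) : DSym p
  | add : DSym p
  | neg : DSym p
  | e (j : Fin h) : DSym p
  | v (j : Fin (h - 1)) : DSym p
  | tick : DSym p
  | sep : DSym p
  | out : DSym p

namespace DSym

variable {h : ℕ} {p : Fin h → ℕ}

/-- The number of a gate is written in unary, followed by a separator. -/
def encodeNum (a : ℕ) : List (DSym p) := List.replicate a tick ++ [sep]

/-- A gate is written as its operation, followed by the numbers of the gates that feed it. -/
def encodeGate : DGate p → List (DSym p)
  | .input => [input]
  | .const d => [const d]
  | .add a b => add :: (encodeNum a ++ encodeNum b)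
  | .neg a => neg :: encodeNum a
  | .e j a => e j :: encodeNum a
  | .v j a => v j :: encodeNum a

/-- A circuit is written as the list of its gates, followed by the numbers of its two output gates.
(The length of this word is between `|Γ|` and a quadratic polynomial of the number `|Γ|` of
gates.) -/
def encodeCircuit (Γ : DCircuit p) : List (DSym p) :=
  Γ.gates.flatMap encodeGate ++ out :: (encodeNum Γ.out₁ ++ encodeNum Γ.out₂)

end DSym

/-- Some deterministic Turing machine (with finitely many stacks) decides the property `P` of the
objects of type `α`, which it gets as words `enc a` over the alphabet `S`, in at most `T (size a)`
steps. It answers with one bit. -/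
def DecidableInTime {α S : Type} (enc : α → List S) (size : α → ℕ) (P : α → Prop) (T : ℕ → ℕ) :
    Prop :=
  ∃ M : Turing.TM2ComputableAux S Bool, ∀ a : α, ∃ answer : Bool, (answer = true ↔ P a) ∧
    Nonempty (Turing.TM2OutputsInTime M.tm ((enc a).map M.inputAlphabet.symm)
      (some ([answer].map M.outputAlphabet.symm)) (T (size a)))

/-! ### Circuits from levelled systems of Boolean functions -/

namespace CCCircuit

variable {h : ℕ} {p : Fin h → ℕ} {n : ℕ}

/-! The point is that solvable equations have sparse solutions. Let `x` be a solution of `out₁ -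
out₂ = a` with the fewest nonzero inputs, say `n` of them, and let Boolean variables switch these
inputs on and off. By minimality the equation survives only if nothing is switched off, so the
switched circuit computes `AND_n` (`exists_maskedValue_iff`). Addition, negation and `e_j` act
linearly on each coordinate, and `v_j` feeds coordinate `j` with the Boolean condition that
coordinate `j + 1` is nonzero. Hence coordinate `l` of every gate is an affine combination modulo
`p_l` of switches and of conditions on the next coordinate, which is the kind of sum that a
`MOD_{p_l}`-gate evaluates (`maskedValue_mem_systemForms`).

The equation is a conjunction of `h` conditions with different moduli, and it has to be expressed
without an additional level. This is done in `exists_circuit_of_system`: the conditions on all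
coordinates but the first are collected on the second level as the vanishing of a vector over
`ℤ_{p₂}` of bounded dimension. By `sum_hyperplanes` the indicator of the origin, times a power of
`p₂`, is a signed sum of indicators of hyperplanes, each of which is one `MOD_{p₂}`-gate. Since `p₂`
is invertible modulo `p₁`, the output gate can sum up such indicators. The resulting circuit has
size `O(|Γ|)`, so `SESH` forces `n = O(log^{h-1} |Γ|)` (`exists_sparse_solution`). For `h = 1`,
where `SESH` says nothing, a pigeonhole argument bounds `n` by `p₁`.

As `a` is arbitrary, both equality and inequality of the outputs are witnessed by sparse valuations
whenever they are witnessed at all. So both problems are decided by testing `|Γ|^{O(log^{h-1} |Γ|)}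
= 2^{O(log^h |Γ|)}` valuations, each in polynomial time. The search is a program in a small language
of stack operations that is compiled to multi-stack machines; `exec_search` bounds its running time
by the number of sparse lists of digits, and `reach_of_weight_le` shows that none of them is missed.
-/

/-- Wires lead only from one level to the preceding one, so the local equations determine all gates,
by induction from the last level. A missing wire contributes `0` with or without the guard in
`value`. -/
theorem value_eq_of_forall (C : CCCircuit p n) (y : Fin n → Bool) (F : C.Gate → Bool)
    (hF : ∀ g, F g = true ↔ ((∑ i, C.inputWires g i * (y i).toNat +
      ∑ g', C.gateWires g g' * (F g').toNat : ℕ) : ZMod (p (C.level g))) ∈ C.accept g)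
    (g : C.Gate) : C.value y g = F g := by
  classical
  induction hd : h - (C.level g : ℕ) using Nat.strong_induction_on generalizing g with
  | _ d ih =>
  have hsum : ∑ g', (if _hw : C.gateWires g g' ≠ 0 then C.gateWires g g' * (C.value y g').toNat
      else 0) = ∑ g', C.gateWires g g' * (F g').toNat := by
    refine Finset.sum_congr rfl fun g' _ => ?_
    split_ifs with hw
    · have h1 := C.gateWires_level g g' hw
      have h2 := (C.level g').isLt
      rw [ih _ (by omega) g' rfl]
    · rw [not_not.1 hw, zero_mul]
  rw [value, hsum, Bool.eq_iff_iff, decide_eq_true_iff, hF]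

/-- The functions that may be summed up by a gate of level `l`, when the gates compute the functions
`F`: linear combinations of `1`, of gates of the next level, and, on the last level, of inputs. -/
def forms {G : Type} (lev : G → Fin h) (F : G → (Fin n → Bool) → Bool) (l : Fin h) :
    Submodule (ZMod (p l)) ((Fin n → Bool) → ZMod (p l)) :=
  Submodule.span _ ({1} ∪ {f | (l : ℕ) + 1 = h ∧ ∃ i, f = fun y => ((y i).toNat : ZMod (p l))} ∪
    {f | ∃ g, (lev g : ℕ) = l + 1 ∧ f = fun y => ((F g y).toNat : ZMod (p l))})

section forms

variable {G : Type} {lev : G → Fin h} {F : G → (Fin n → Bool) → Bool} {l : Fin h}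

theorem one_mem_forms : (1 : (Fin n → Bool) → ZMod (p l)) ∈ forms lev F l :=
  Submodule.subset_span (Or.inl (Or.inl rfl))

theorem input_mem_forms (hl : (l : ℕ) + 1 = h) (i : Fin n) :
    (fun y => ((y i).toNat : ZMod (p l))) ∈ forms lev F l :=
  Submodule.subset_span (Or.inl (Or.inr ⟨hl, i, rfl⟩))

theorem gate_mem_forms {g : G} (hg : (lev g : ℕ) = l + 1) :
    (fun y => ((F g y).toNat : ZMod (p l))) ∈ forms lev F l :=
  Submodule.subset_span (Or.inr ⟨g, hg, rfl⟩)

theorem exists_coeff_of_mem_forms [Fintype G] {f : (Fin n → Bool) → ZMod (p l)}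
    (hf : f ∈ forms lev F l) :
    ∃ (a : ZMod (p l)) (c : Fin n → ZMod (p l)) (w : G → ZMod (p l)),
      (∀ i, c i ≠ 0 → (l : ℕ) + 1 = h) ∧ (∀ g, w g ≠ 0 → (lev g : ℕ) = l + 1) ∧
      ∀ y, f y = a + (∑ i, c i * ((y i).toNat : ZMod (p l)) +
        ∑ g, w g * ((F g y).toNat : ZMod (p l))) := by
  classical
  induction hf using Submodule.span_induction with
  | mem f hf =>
    rcases hf with (rfl | ⟨hl, i, rfl⟩) | ⟨g, hg, rfl⟩
    · exact ⟨1, 0, 0, by simp, by simp, by simp⟩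
    · refine ⟨0, Pi.single i 1, 0, fun _ _ => hl, by simp, fun y => ?_⟩
      simp [Pi.single_apply]
    · refine ⟨0, 0, Pi.single g 1, by simp, fun g' hg' => ?_, fun y => ?_⟩
      · have : g' = g := by
          by_contra hne
          exact hg' (Pi.single_eq_of_ne hne _)
        rw [this, hg]
      · simp [Pi.single_apply]
  | zero => exact ⟨0, 0, 0, by simp, by simp, by simp⟩
  | add f f' _ _ ih ih' =>
    obtain ⟨a, c, w, h₁, h₂, h₃⟩ := ih
    obtain ⟨a', c', w', h₁', h₂', h₃'⟩ := ih'
    refine ⟨a + a', c + c', w + w', fun i hi => ?_, fun g hg => ?_, fun y => ?_⟩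
    · by_cases hc : c i = 0
      · exact h₁' i fun hc' => hi (by simp [hc, hc'])
      · exact h₁ i hc
    · by_cases hc : w g = 0
      · exact h₂' g fun hc' => hg (by simp [hc, hc'])
      · exact h₂ g hc
    · simp only [Pi.add_apply, h₃, h₃', add_mul, Finset.sum_add_distrib]
      ring
  | smul r f _ ih =>
    obtain ⟨a, c, w, h₁, h₂, h₃⟩ := ih
    refine ⟨r * a, r • c, r • w, fun i hi => h₁ i fun hc => hi (by simp [hc]),
      fun g hg => h₂ g fun hc => hg (by simp [hc]), fun y => ?_⟩
    simp only [Pi.smul_apply, smul_eq_mul, h₃, mul_add, Finset.mul_sum, mul_assoc]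

end forms

/-- A family of Boolean functions arranged in levels, in which each function depends on a sum of
functions of the next level, is computed by a circuit. -/
theorem exists_of_forms [∀ l, NeZero (p l)] {G : Type} [Fintype G] (lev : G → Fin h)
    (F : G → (Fin n → Bool) → Bool) (out : G) (hout : (lev out : ℕ) = 0)
    (hF : ∀ g, ∃ f ∈ forms lev F (lev g), ∃ R : Set (ZMod (p (lev g))),
      ∀ y, F g y = true ↔ f y ∈ R) :
    ∃ C : CCCircuit p n, C.size = Fintype.card G ∧ ∀ y, C.value y C.output = F out y := by
  -- Coefficients in `ZMod (p l)` become multiplicities of wires through `ZMod.val`; the constant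
  -- term is absorbed into the accepting set.
  choose f hf R hR using hF
  choose a c w h₁ h₂ h₃ using fun g => exists_coeff_of_mem_forms (hf g)
  let C : CCCircuit p n :=
    { Gate := G
      level := lev
      accept := fun g => {r | a g + r ∈ R g}
      inputWires := fun g i => (c g i).val
      gateWires := fun g g' => (w g g').val
      inputWires_level := fun g i hi => h₁ g i fun h0 => hi (by simp [h0])
      gateWires_level := fun g g' hi => h₂ g g' fun h0 => hi (by simp [h0])
      output := out
      output_level := hout }
  refine ⟨C, rfl, fun y => C.value_eq_of_forall y (fun g => F g y) (fun g => ?_) out⟩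
  rw [hR, h₃]
  simp [C]

end CCCircuit

/-! ### A conjunction of equations in different moduli, without an additional level -/

/-- A point is the origin iff it lies on as many hyperplanes `a · w = 0` as on hyperplanes
`a · w = 1` modulo the characteristic. -/
theorem sum_hyperplanes {P : ℕ} [Fact P.Prime] {ι R : Type*} [Fintype ι] [DecidableEq ι] [CommRing R]
    (w : ι → ZMod P) :
    ∑ a : ι → ZMod P, (((decide (∑ i, a i * w i = 0)).toNat : R) -
      ((decide (∑ i, a i * w i = 1)).toNat : R)) =
      (P : R) ^ Fintype.card ι * ((decide (w = 0)).toNat : R) := by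
  by_cases hw : w = 0
  · simp [hw, ZMod.card]
  · obtain ⟨i, hi⟩ := Function.ne_iff.1 hw
    rw [Finset.sum_sub_distrib, sub_eq_zero.2]
    · simp [hw]
    -- For `w i ≠ 0`, subtracting `(w i)⁻¹` from the `i`-th entry of `a` lowers `a · w` by `1`, so
    -- equally many `a` give the values `0` and `1`.
    · rw [← Equiv.sum_comp (Equiv.addRight (Pi.single i (-(w i)⁻¹) : ι → ZMod P))]
      refine (Finset.sum_congr rfl fun a _ => ?_)
      congr 3
      have : ∑ j, (Pi.single i (-(w i)⁻¹) : ι → ZMod P) j * w j = -1 := by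
        rw [Finset.sum_eq_single i]
        · rw [Pi.single_eq_same, neg_mul, inv_mul_cancel₀ hi]
        · intro j _ hj; simp [hj]
        · simp
      simp [add_mul, Finset.sum_add_distrib, this, ← sub_eq_add_neg, sub_eq_zero]

/-- The functions that a value of level `l` may be, in a system of functions `val` of Boolean
variables: linear combinations of `1`, of the variables, and of the conditions that values of the
next level are nonzero. -/
def systemForms {h : ℕ} {p : Fin h → ℕ} {n : ℕ} {ι : Type}
    (val : (l : Fin h) → ι → (Fin n → Bool) → ZMod (p l)) (l : Fin h) :
    Submodule (ZMod (p l)) ((Fin n → Bool) → ZMod (p l)) :=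
  Submodule.span _ ({1} ∪ {f | ∃ i, f = fun y => ((y i).toNat : ZMod (p l))} ∪
    {f | ∃ (l' : Fin h) (k : ι), (l' : ℕ) = l + 1 ∧
      f = fun y => ((decide (val l' k y ≠ 0)).toNat : ZMod (p l))})

section system

variable {h : ℕ} {p : Fin h → ℕ} {n : ℕ} {ι : Type} [Fintype ι]

/-- The gates of a circuit for a conjunction of equations in a system: gates for variables and for
conditions, gates for hyperplanes, and the output gate. -/
abbrev SystemGate (h P n : ℕ) (ι : Type) : Type :=
  (Fin h × (Fin n ⊕ (Fin h × ι))) ⊕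
    (((Fin n ⊕ ι ⊕ Unit) × (Option (Fin h) → ZMod P) × Bool) ⊕ Unit)

/-- Two obstacles are removed here. In a system, variables occur on every level and not only on the
last one; relay gates carry them, and conditions from deeper levels, upwards. And the conditions
`val l k y = 0` for all `l` have to be joined by the output gate itself: the levels after the first
enter through the indicator of a point over `ZMod (p l₁)`, with which the form on the first level is
multiplied. For fixed `p` the size stays linear in the number of variables and of functions. -/
theorem exists_circuit_of_system (hh : 1 < h) (hp : AlternatingPrimes p)
    (val : (l : Fin h) → ι → (Fin n → Bool) → ZMod (p l))
    (hval : ∀ l k, val l k ∈ systemForms val l) (k : ι) :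
    ∃ C : CCCircuit p n, C.size ≤ (h + h * h + 2 * p ⟨1, hh⟩ ^ (h + 1) + 1) *
        (n + Fintype.card ι + 1) ∧
      ∀ y, C.value y C.output = true ↔ ∀ l, val l k y = 0 := by
  classical
  have hprime : ∀ l, Fact (p l).Prime := fun l => ⟨hp.1 l⟩
  have hne : ∀ l, NeZero (p l) := fun l => ⟨(hp.1 l).ne_zero⟩
  have toNat_ne_zero : ∀ (l : Fin h) (b : Bool), ((b.toNat : ℕ) : ZMod (p l)) ≠ 0 ↔ b = true := by
    intro l b
    cases b <;> simp
  let l₀ : Fin h := ⟨0, by omega⟩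
  let l₁ : Fin h := ⟨1, hh⟩
  let P := p l₁
  let m : (Fin n ⊕ ι ⊕ Unit) → (Fin n → Bool) → ZMod (p l₁) := fun s y => match s with
    | .inl i => ((y i).toNat : ZMod (p l₁))
    | .inr (.inl k') => val l₁ k' y
    | .inr (.inr _) => 0
  -- The vector whose vanishing expresses the conditions on all levels but the first. On level `l₁`
  -- the form itself is available; deeper levels have other moduli, so only their Boolean conditions
  -- are relayed. The first level gets the dummy entry `0`. The additional entry `m s`, at the index
  -- `none`, is used for products in `mul_mem`.
  let u : Fin h → (Fin n → Bool) → ZMod (p l₁) := fun l y =>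
    if (l : ℕ) = 0 then 0 else if (l : ℕ) = 1 then val l₁ k y else
      ((decide (val l k y ≠ 0)).toNat : ZMod (p l₁))
  let lin : (Fin n ⊕ ι ⊕ Unit) → (Option (Fin h) → ZMod P) → (Fin n → Bool) → ZMod (p l₁) :=
    fun s a y => ∑ i : Option (Fin h), a i * i.elim (m s y) (fun l => u l y)
  let lev : SystemGate h P n ι → Fin h := fun g => match g with
    | .inl (l, _) => l
    | .inr (.inl _) => l₁
    | .inr (.inr _) => l₀
  let F : SystemGate h P n ι → (Fin n → Bool) → Bool := fun g y => match g with
    | .inl (_, .inl i) => y i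
    -- For `l = l'` this gate evaluates the condition, for `l < l'` it relays it from the next
    -- level, and for `l' < l` it is a dummy with the value `false`.
    | .inl (l, .inr (l', k')) => decide (l ≤ l' ∧ val l' k' y ≠ 0)
    | .inr (.inl (s, a, r)) => decide (lin s a y = if r then 1 else 0)
    | .inr (.inr _) => decide (∀ l, val l k y = 0)
  have input_mem : ∀ (l : Fin h) (i : Fin n),
      (fun y => ((y i).toNat : ZMod (p l))) ∈ CCCircuit.forms lev F l := by
    intro l i
    by_cases hl : (l : ℕ) + 1 = h
    · exact CCCircuit.input_mem_forms hl i
    · exact CCCircuit.gate_mem_forms (F := F)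
        (g := (Sum.inl (⟨l + 1, by omega⟩, .inl i) : SystemGate h P n ι)) rfl
  have cond_mem : ∀ (l l' : Fin h) (k' : ι), l < l' →
      (fun y => ((decide (val l' k' y ≠ 0)).toNat : ZMod (p l))) ∈ CCCircuit.forms lev F l := by
    intro l l' k' hl
    have hl' : (l : ℕ) + 1 ≤ l' := hl
    have hle : (⟨l + 1, by omega⟩ : Fin h) ≤ l' := hl'
    have := CCCircuit.gate_mem_forms (p := p) (lev := lev) (F := F) (l := l)
      (g := (Sum.inl (⟨l + 1, by omega⟩, .inr (l', k')) : SystemGate h P n ι)) rfl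
    simpa only [F, hle, true_and] using this
  have val_mem : ∀ (l : Fin h) (k' : ι), val l k' ∈ CCCircuit.forms lev F l := by
    intro l k'
    refine Submodule.span_le.2 ?_ (hval l k')
    rintro f ((rfl | ⟨i, rfl⟩) | ⟨l', k', hl, rfl⟩)
    · exact CCCircuit.one_mem_forms
    · exact input_mem l i
    · exact cond_mem l l' k' (Fin.lt_def.2 (by omega))
  have lin_mem : ∀ s a, lin s a ∈ CCCircuit.forms lev F l₁ := by
    intro s a
    have : lin s a = ∑ i : Option (Fin h), a i • i.elim (m s) u := by
      funext y
      simp only [lin, Finset.sum_apply, Pi.smul_apply, smul_eq_mul]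
      refine Finset.sum_congr rfl fun i _ => ?_
      cases i <;> rfl
    rw [this]
    refine Submodule.sum_mem _ fun i _ => Submodule.smul_mem _ _ ?_
    rcases i with _ | l
    · rcases s with i | k' | _
      · exact input_mem l₁ i
      · exact val_mem l₁ k'
      · exact Submodule.zero_mem _
    · simp only [Option.elim_some, u]
      split_ifs with h₀ h₁
      · exact Submodule.zero_mem _
      · exact val_mem l₁ k
      · exact cond_mem l₁ l k (Fin.lt_def.2 (by simp only [l₁]; omega))
  have point_mem : ∀ s, (fun y => ((decide (m s y = 0 ∧ ∀ l, u l y = 0)).toNat : ZMod (p l₀))) ∈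
      CCCircuit.forms lev F l₀ := by
    intro s
    -- The only use of `p₁ ≠ p₂` in the construction: the factor in `sum_hyperplanes` is invertible
    -- modulo `p l₀`.
    have hP : ((P : ZMod (p l₀)) ^ (Fintype.card (Option (Fin h)))) ≠ 0 := by
      refine pow_ne_zero _ fun h0 => ?_
      rw [ZMod.natCast_eq_zero_iff, Nat.prime_dvd_prime_iff_eq (hp.1 _) (hp.1 _)] at h0
      exact hp.2 l₀ l₁ rfl h0
    rw [← Submodule.smul_mem_iff _ hP]
    have hsum : ((P : ZMod (p l₀)) ^ (Fintype.card (Option (Fin h)))) •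
        (fun y => ((decide (m s y = 0 ∧ ∀ l, u l y = 0)).toNat : ZMod (p l₀))) =
        ∑ a : Option (Fin h) → ZMod P,
          ((fun y => ((F (.inr (.inl (s, a, false))) y).toNat : ZMod (p l₀))) -
            (fun y => ((F (.inr (.inl (s, a, true))) y).toNat : ZMod (p l₀)))) := by
      funext y
      have := sum_hyperplanes (R := ZMod (p l₀))
        (fun i : Option (Fin h) => i.elim (m s y) (fun l => u l y))
      simp only [Finset.sum_apply, Pi.sub_apply, Pi.smul_apply, smul_eq_mul, F, lin, if_true,
        Bool.false_eq_true, if_false]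
      rw [this]
      congr 3
      rw [decide_eq_decide, funext_iff, Option.forall]
      simp
    rw [hsum]
    exact Submodule.sum_mem _ fun a _ =>
      Submodule.sub_mem _
        (CCCircuit.gate_mem_forms (F := F) (g := (Sum.inr (Sum.inl (s, a, false)))) rfl)
        (CCCircuit.gate_mem_forms (F := F) (g := (Sum.inr (Sum.inl (s, a, true)))) rfl)
  -- It suffices to multiply generators. For a Boolean `b`, the product of `b` and `[u = 0]` is `[u
  -- = 0] - [b = 0 ∧ u = 0]`, a difference of two indicators of points.
  have mul_mem : ∀ f ∈ systemForms val l₀,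
      (fun y => f y * ((decide (∀ l, u l y = 0)).toNat : ZMod (p l₀))) ∈
        CCCircuit.forms lev F l₀ := by
    have hunit := point_mem (.inr (.inr ()))
    simp only [m, true_and] at hunit
    intro f hf
    induction hf using Submodule.span_induction with
    | mem f hf =>
      rcases hf with (rfl | ⟨i, rfl⟩) | ⟨l', k', hl, rfl⟩
      · simpa using hunit
      · convert! Submodule.sub_mem _ hunit (point_mem (.inl i)) using 1
        funext y
        by_cases hu : ∀ l, u l y = 0 <;> cases hy : y i <;> simp [hu, hy, m]
      · obtain rfl : l' = l₁ := Fin.ext hl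
        convert! Submodule.sub_mem _ hunit (point_mem (.inr (.inl k'))) using 1
        funext y
        by_cases hu : ∀ l, u l y = 0 <;> by_cases hy : val l₁ k' y = 0 <;> simp [hu, hy, m, l₁]
    | zero =>
      simp only [Pi.zero_apply, zero_mul]
      exact Submodule.zero_mem _
    | add f f' _ _ ih ih' => simpa only [Pi.add_apply, add_mul] using! Submodule.add_mem _ ih ih'
    | smul r f _ ih =>
      simpa only [Pi.smul_apply, smul_eq_mul, mul_assoc] using! Submodule.smul_mem _ r ih
  have hu_iff : ∀ y, (∀ l, u l y = 0) ↔ ∀ l : Fin h, l ≠ l₀ → val l k y = 0 := by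
    intro y
    refine forall_congr' fun l => ?_
    simp only [u]
    split_ifs with h₀ h₁
    · simp [show l = l₀ from Fin.ext h₀]
    · obtain rfl : l = l₁ := Fin.ext h₁
      simp [l₀, l₁]
    · have : l ≠ l₀ := fun hl => h₀ (congrArg Fin.val hl)
      by_cases hv : val l k y = 0 <;> simp [hv, this]
  obtain ⟨C, hC, hC'⟩ := CCCircuit.exists_of_forms lev F (.inr (.inr ())) rfl (by
    rintro (⟨l, i | ⟨l', k'⟩⟩ | ⟨⟨s, a, r⟩ | _⟩)
    · exact ⟨_, input_mem l i, {r | r ≠ 0}, fun y => (toNat_ne_zero l (y i)).symm⟩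
    · rcases lt_trichotomy l l' with hl | rfl | hl
      · refine ⟨_, cond_mem l l' k' hl, {r | r ≠ 0}, fun y => ?_⟩
        rw [Set.mem_ofPred_eq, toNat_ne_zero l]
        simp [F, hl.le]
      · refine ⟨_, val_mem l k', {r | r ≠ 0}, fun y => ?_⟩
        simp [F]
      · refine ⟨0, Submodule.zero_mem _, ∅, fun y => ?_⟩
        simp [F, hl]
    · refine ⟨_, lin_mem s a, {if r then 1 else 0}, fun y => ?_⟩
      simp [F]
    -- With `f = val l₀ k`, the function `(f - 1) · [u = 0]` takes the value `-1` exactly if `u = 0`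
    -- and `f = 0`: where `u ≠ 0` it is `0`, which differs from `-1`.
    · refine ⟨_, mul_mem _ (Submodule.sub_mem _ (hval l₀ k)
        (Submodule.subset_span (Or.inl (Or.inl rfl)))), {-1}, fun y => ?_⟩
      simp only [F, decide_eq_true_eq, Pi.sub_apply, Pi.one_apply, Set.mem_singleton_iff]
      by_cases hu : ∀ l, u l y = 0
      · have hu' := (hu_iff y).1 hu
        simp only [hu, implies_true, decide_true, Bool.toNat_true, Nat.cast_one, mul_one,
          sub_eq_neg_self]
        refine ⟨fun h' => h' l₀, fun h' l => ?_⟩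
        by_cases hl : l = l₀
        · rw [hl, h']
        · exact hu' l hl
      · have hu' := mt (hu_iff y).2 hu
        simp only [hu, decide_false, Bool.toNat_false, Nat.cast_zero, mul_zero]
        refine ⟨fun h' => absurd (fun l _ => h' l) hu', fun h' => ?_⟩
        exact absurd h' (by simp))
  refine ⟨C, ?_, fun y => by rw [hC']; simp [F]⟩
  rw [hC]
  simp only [Fintype.card_sum, Fintype.card_prod, Fintype.card_fin, Fintype.card_unique,
    Fintype.card_fun, Fintype.card_option, ZMod.card, Fintype.card_bool, P, l₁]
  generalize p ⟨1, hh⟩ ^ (h + 1) = Q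
  generalize Fintype.card ι = c
  nlinarith [Nat.zero_le (h * h * n), Nat.zero_le (h * c), Nat.zero_le (h * h), Nat.zero_le (Q * n)]

end system

/-! ### Sparse solutions of equations over the algebra -/

namespace DCircuit

variable {h : ℕ} {p : Fin h → ℕ}

theorem foldl_eq_append (gs : List (DGate p)) (x : ℕ → DAlg p) (vals : List (DAlg p)) :
    ∃ l, l.length = gs.length ∧
      gs.foldl (fun vals g => vals ++ [g.value vals (x vals.length)]) vals = vals ++ l := by
  induction gs generalizing vals with
  | nil => exact ⟨[], rfl, by simp⟩
  | cons g gs ih =>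
    obtain ⟨l, hl, h⟩ := ih (vals ++ [g.value vals (x vals.length)])
    exact ⟨g.value vals (x vals.length) :: l, by simp [hl], by simp [h]⟩

theorem _root_.DGate.value_congr (g : DGate p) {vals vals' : List (DAlg p)} {y : DAlg p}
    (h : ∀ a ∈ g.args, vals.getD a 0 = vals'.getD a 0) : g.value vals y = g.value vals' y := by
  cases g <;> simp_all [DGate.value, DGate.args]

/-- The value of a gate is computed from the values of the gates that feed it. -/
theorem value_eq (Γ : DCircuit p) (x : ℕ → DAlg p) (k : ℕ) (hk : k < Γ.gates.length) :
    Γ.value x k = (Γ.gates[k]).value (Γ.values x) (x k) := by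
  obtain ⟨l, hl, h⟩ := foldl_eq_append (Γ.gates.take k) x []
  rw [List.nil_append] at h
  rw [List.length_take_of_le hk.le] at hl
  obtain ⟨l', -, h'⟩ := foldl_eq_append (Γ.gates.drop (k + 1)) x
    (l ++ [(Γ.gates[k]).value l (x k)])
  have hv : Γ.values x = l ++ [(Γ.gates[k]).value l (x k)] ++ l' := by
    rw [values, ← h']
    conv_lhs => rw [← List.take_append_drop k Γ.gates, List.foldl_append, h,
      List.drop_eq_getElem_cons hk, List.foldl_cons]
    simp [hl]
  rw [value, hv, List.append_assoc, List.getD_append_right _ _ _ _ hl.le]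
  simp only [hl, Nat.sub_self, List.singleton_append, List.getD_cons_zero]
  refine DGate.value_congr _ fun a ha => ?_
  have := Γ.args_lt k hk a ha
  rw [List.getD_append _ _ _ _ (by omega)]

theorem value_congr (Γ : DCircuit p) {x x' : ℕ → DAlg p} (h : ∀ k < Γ.size, x k = x' k) (k : ℕ)
    (hk : k < Γ.size) : Γ.value x k = Γ.value x' k := by
  induction k using Nat.strong_induction_on with
  | _ k ih =>
  rw [value_eq _ _ _ hk, value_eq _ _ _ hk, h k hk]
  refine DGate.value_congr _ fun a ha => ?_
  have := Γ.args_lt k hk a ha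
  exact ih a this (this.trans hk)

/-- The numbers of the gates to which a valuation assigns nonzero values. -/
def support (Γ : DCircuit p) (x : ℕ → DAlg p) : Finset ℕ := (Finset.range Γ.size).filter (x · ≠ 0)

/-- A valuation of which those values are erased that belong to false Boolean variables, where the
`i`-th variable belongs to the gate `e i`. -/
def mask {n : ℕ} (e : Fin n → ℕ) (x : ℕ → DAlg p) (y : Fin n → Bool) (k : ℕ) : DAlg p :=
  ∑ i, if e i = k ∧ y i = true then x k else 0

/-- The values of the gates of a circuit under masked valuations, and, at the index `none`, the
difference between the difference of the values of the two output gates and `a`. -/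
def maskedValue (Γ : DCircuit p) {n : ℕ} (e : Fin n → ℕ) (x : ℕ → DAlg p) (a : DAlg p) (l : Fin h) :
    Option (Fin Γ.size) → (Fin n → Bool) → ZMod (p l)
  | none, y => (Γ.value (mask e x y) Γ.out₁ - Γ.value (mask e x y) Γ.out₂ - a) l
  | some k, y => Γ.value (mask e x y) k l

/-- By induction along the circuit: a masked input is a constant times a variable, the group
operations and `e_j` are linear in each coordinate, and `v_j` yields in coordinate `j` the condition
on coordinate `j + 1` of an earlier gate, which is a generator. -/
theorem maskedValue_mem_systemForms (Γ : DCircuit p) {n : ℕ} (e : Fin n → ℕ) (x : ℕ → DAlg p)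
    (a : DAlg p) (l : Fin h) (k : Option (Fin Γ.size)) :
    Γ.maskedValue e x a l k ∈ systemForms (Γ.maskedValue e x a) l := by
  have const_mem : ∀ (l : Fin h) (c : ZMod (p l)),
      (fun _ => c) ∈ systemForms (Γ.maskedValue e x a) l := by
    intro l c
    have h1 : (1 : (Fin n → Bool) → ZMod (p l)) ∈ systemForms (Γ.maskedValue e x a) l :=
      Submodule.subset_span (Or.inl (Or.inl rfl))
    convert! Submodule.smul_mem _ c h1 using 1
    funext y
    simp
  have key : ∀ (k : ℕ) (hk : k < Γ.size) (l : Fin h),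
      (fun y => Γ.value (mask e x y) k l) ∈ systemForms (Γ.maskedValue e x a) l := by
    intro k
    induction k using Nat.strong_induction_on with
    | _ k ih =>
    intro hk l
    have hargs := Γ.args_lt k hk
    simp only [value_eq Γ _ k hk]
    rcases hg : Γ.gates[k] with _ | d | ⟨b, c⟩ | b | ⟨j, b⟩ | ⟨j, b⟩
    all_goals
      rw [hg] at hargs
      simp only [DGate.value]
    · have : (fun y => mask e x y k l) = ∑ i, (if e i = k then x k l else 0) •
          (fun y : Fin n → Bool => ((y i).toNat : ZMod (p l))) := by
        funext y
        simp only [mask, Finset.sum_apply, Pi.smul_apply, smul_eq_mul]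
        refine Finset.sum_congr rfl fun i _ => ?_
        by_cases he : e i = k <;> cases hy : y i <;> simp [he]
      rw [this]
      exact Submodule.sum_mem _ fun i _ => Submodule.smul_mem _ _
        (Submodule.subset_span (Or.inl (Or.inr ⟨i, rfl⟩)))
    · exact const_mem l (d l)
    · have hb := hargs b (by simp [DGate.args])
      have hc := hargs c (by simp [DGate.args])
      exact Submodule.add_mem _ (ih b hb (hb.trans hk) l) (ih c hc (hc.trans hk) l)
    · have hb := hargs b (by simp [DGate.args])
      exact Submodule.neg_mem _ (ih b hb (hb.trans hk) l)
    · have hb := hargs b (by simp [DGate.args])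
      by_cases hj : l = j
      · subst hj
        simpa only [DAlg.e, Pi.single_eq_same, value] using ih b hb (hb.trans hk) l
      · simpa only [DAlg.e, Pi.single_eq_of_ne hj] using const_mem l 0
    · have hb := hargs b (by simp [DGate.args])
      by_cases hj : l = ⟨j, by omega⟩
      · subst hj
        simp only [DAlg.v, Pi.single_eq_same]
        refine Submodule.subset_span (Or.inr ⟨⟨j + 1, by omega⟩, some ⟨b, hb.trans hk⟩, rfl, ?_⟩)
        funext y
        simp only [maskedValue, value]
        split_ifs with h0 <;> simp only [h0, ne_eq, not_true_eq_false, not_false_eq_true] <;> simp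
      · simpa only [DAlg.v, Pi.single_eq_of_ne hj] using const_mem l 0
  cases k with
  | some k => exact key k k.isLt l
  | none =>
    exact Submodule.sub_mem _ (Submodule.sub_mem _ (key _ Γ.out₁_lt l) (key _ Γ.out₂_lt l))
      (const_mem l (a l))

/-- Masked solutions of an equation with a minimal number of nonzero inputs compute a conjunction. -/
theorem exists_maskedValue_iff (Γ : DCircuit p) (a : DAlg p)
    (hsol : ∃ x : ℕ → DAlg p, Γ.value x Γ.out₁ - Γ.value x Γ.out₂ = a) :
    ∃ x : ℕ → DAlg p, Γ.value x Γ.out₁ - Γ.value x Γ.out₂ = a ∧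
      ∃ e : Fin (Γ.support x).card → ℕ, ∀ y,
        (∀ l, Γ.maskedValue e x a l none y = 0) ↔ ∀ i, y i = true := by
  classical
  obtain ⟨x, hx, hmin⟩ : ∃ x : ℕ → DAlg p, Γ.value x Γ.out₁ - Γ.value x Γ.out₂ = a ∧
      ∀ x' : ℕ → DAlg p, Γ.value x' Γ.out₁ - Γ.value x' Γ.out₂ = a →
        (Γ.support x).card ≤ (Γ.support x').card := by
    have := exists_minimalFor_of_wellFoundedLT
      (fun x : ℕ → DAlg p => Γ.value x Γ.out₁ - Γ.value x Γ.out₂ = a)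
      (fun x => (Γ.support x).card) hsol
    obtain ⟨x, hx, hmin⟩ := this
    refine ⟨x, hx, fun x' hx' => ?_⟩
    rcases le_total (Γ.support x).card (Γ.support x').card with hle | hle
    · exact hle
    · exact hmin hx' hle
  let E := (Γ.support x).equivFin.symm
  let e : Fin (Γ.support x).card → ℕ := fun i => E i
  have he : ∀ i j, e i = e j → i = j := fun i j hij => E.injective (Subtype.ext hij)
  have hmask : ∀ y i, mask e x y (e i) = if y i = true then x (e i) else 0 := by
    intro y i
    rw [mask, Finset.sum_eq_single i]
    · simp
    · intro j _ hj
      rw [if_neg fun h' => hj (he j i h'.1)]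
    · simp
  have hmask' : ∀ y k, k ∉ Γ.support x → mask e x y k = 0 := by
    intro y k hk
    refine Finset.sum_eq_zero fun i _ => if_neg fun h' => hk ?_
    rw [← h'.1]
    exact (E i).2
  refine ⟨x, hx, e, fun y => ?_⟩
  have hiff : (∀ l, Γ.maskedValue e x a l none y = 0) ↔
      Γ.value (mask e x y) Γ.out₁ - Γ.value (mask e x y) Γ.out₂ = a := by
    rw [← sub_eq_zero, funext_iff]
    rfl
  rw [hiff]
  constructor
  · intro hy
    by_contra! hne
    obtain ⟨i, hi⟩ := hne
    -- A false variable erases a nonzero input, so this solution would have a smaller support than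
    -- `x`.
    have hsub : Γ.support (mask e x y) ⊂ Γ.support x := by
      refine Finset.ssubset_iff_of_subset (fun k hk => ?_) |>.2 ⟨e i, (E i).2, fun hk => ?_⟩
      · by_contra hk'
        exact (Finset.mem_filter.1 hk).2 (hmask' y k hk')
      · refine (Finset.mem_filter.1 hk).2 ?_
        rw [hmask, if_neg hi]
    exact absurd (hmin _ hy) (not_le.2 (Finset.card_lt_card hsub))
  · intro hy
    have hcongr : ∀ k < Γ.size, mask e x y k = x k := by
      intro k hk
      by_cases hk' : k ∈ Γ.support x
      · obtain ⟨i, hi⟩ := E.surjective ⟨k, hk'⟩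
        have hi' : e i = k := congrArg Subtype.val hi
        rw [← hi', hmask, if_pos (hy i)]
      · rw [hmask' y k hk']
        by_contra hne
        exact hk' (Finset.mem_filter.2 ⟨Finset.mem_range.2 hk, fun h0 => hne h0.symm⟩)
    rw [Γ.value_congr hcongr _ Γ.out₁_lt, Γ.value_congr hcongr _ Γ.out₂_lt, hx]

theorem card_support_le (Γ : DCircuit p) (x : ℕ → DAlg p) : (Γ.support x).card ≤ Γ.size :=
  (Finset.card_filter_le _ _).trans (by simp)

/-- If the algebra has only one prime, solvable equations have solutions with a bounded number of
nonzero inputs. -/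
theorem exists_sparse_solution_of_eq_one (hh : h = 1) (hp : AlternatingPrimes p) (Γ : DCircuit p)
    (a : DAlg p) (hsol : ∃ x : ℕ → DAlg p, Γ.value x Γ.out₁ - Γ.value x Γ.out₂ = a) :
    ∃ x : ℕ → DAlg p, Γ.value x Γ.out₁ - Γ.value x Γ.out₂ = a ∧
      (Γ.support x).card ≤ p ⟨0, by omega⟩ := by
  obtain ⟨x, hx, e, he⟩ := Γ.exists_maskedValue_iff a hsol
  refine ⟨x, hx, ?_⟩
  by_contra! hlt
  generalize (Γ.support x).card = n at e he hlt
  let l₀ : Fin h := ⟨0, by omega⟩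
  have : NeZero (p l₀) := ⟨(hp.1 _).ne_zero⟩
  have hl : ∀ l : Fin h, l = l₀ := fun l => Fin.ext (by simp only [l₀]; omega)
  -- With a single level there are no conditions, so forms are affine in the Boolean variables and
  -- hence modular on the lattice of Boolean vectors.
  have modular : ∀ f ∈ systemForms (Γ.maskedValue e x a) l₀, ∀ y z : Fin n → Bool,
      f (fun i => y i || z i) + f (fun i => y i && z i) = f y + f z := by
    intro f hf y z
    induction hf using Submodule.span_induction with
    | mem f hf =>
      rcases hf with (rfl | ⟨i, rfl⟩) | ⟨l', k', hl', rfl⟩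
      · simp
      · cases hy : y i <;> cases hz : z i <;> simp [hy, hz]
      · have := l'.isLt
        simp only [l₀] at hl'
        omega
    | zero => simp
    | add f f' _ _ ih ih' =>
      simp only [Pi.add_apply]
      linear_combination ih + ih'
    | smul r f _ ih =>
      simp only [Pi.smul_apply, smul_eq_mul]
      linear_combination r * ih
  have hf := modular _ (Γ.maskedValue_mem_systemForms e x a l₀ none)
  have he' : ∀ y, Γ.maskedValue e x a l₀ none y = 0 ↔ ∀ i, y i = true := by
    intro y
    rw [← he y]
    exact ⟨fun h' l => by rw [hl l]; exact h', fun h' => h' l₀⟩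
  generalize Γ.maskedValue e x a l₀ none = f at hf he'
  -- There are `n > p` initial segments of `Fin n` and only `p` values of `f`, so `f` agrees on two
  -- of them.
  obtain ⟨i, j, hij, hfij⟩ := Fintype.exists_ne_map_eq_of_card_lt
    (fun j : Fin n => f fun i => decide (i < j)) (by rw [ZMod.card]; simpa using hlt)
  wlog hlt' : i < j generalizing i j
  · exact this j i hij.symm hfij.symm (lt_of_le_of_ne (not_lt.1 hlt') hij.symm)
  -- The set `{k < i} ∪ {j ≤ k}` and the segment `{k < j}` have union everything, where `f` is `0`,
  -- and intersection `{k < i}`. Modularity makes `f` vanish on the first set, although it omits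
  -- `i`.
  have h₁ := hf (fun k => decide (k < i) || decide (j ≤ k)) (fun k => decide (k < j))
  have h₂ : (fun k => (decide (k < i) || decide (j ≤ k)) || decide (k < j)) =
      fun _ : Fin n => true := by
    funext k
    rcases lt_or_ge k j with hk | hk <;> simp [hk]
  have h₃ : (fun k => (decide (k < i) || decide (j ≤ k)) && decide (k < j)) =
      fun k : Fin n => decide (k < i) := by
    funext k
    rcases lt_or_ge k j with hk | hk
    · simp [hk, not_le.2 hk]
    · simp [not_lt.2 hk, not_lt.2 (hlt'.le.trans hk)]
  rw [h₂, h₃, (he' _).2 (fun _ => rfl), zero_add] at h₁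
  rw [hfij, right_eq_add] at h₁
  have := (he' _).1 h₁ i
  simp [not_le.2 hlt'] at this

open Real in
/-- Under `SESH`, solvable equations have solutions with a polylogarithmic number of nonzero
inputs. -/
theorem exists_sparse_solution (hSESH : SESH) (hh : 1 ≤ h) (hp : AlternatingPrimes p) :
    ∃ A : ℕ, ∀ (Γ : DCircuit p) (a : DAlg p),
      (∃ x : ℕ → DAlg p, Γ.value x Γ.out₁ - Γ.value x Γ.out₂ = a) →
      ∃ x : ℕ → DAlg p, Γ.value x Γ.out₁ - Γ.value x Γ.out₂ = a ∧
        (Γ.support x).card ≤ A * Γ.size.size ^ (h - 1) := by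
  rcases hh.eq_or_lt' with rfl | hh'
  · refine ⟨p ⟨0, by omega⟩, fun Γ a hsol => ?_⟩
    simpa using exists_sparse_solution_of_eq_one rfl hp Γ a hsol
  obtain ⟨c, hc, K, hK, hev⟩ := hSESH h p hh' hp
  obtain ⟨n₀, hn₀⟩ := Filter.eventually_atTop.1 hev
  generalize hD : h + h * h + 2 * p ⟨1, hh'⟩ ^ (h + 1) + 1 = D
  have hDpos : 0 < D := by omega
  -- Taking logarithms in `K * 2 ^ (c * n ^ (1 / (h - 1))) ≤ 4 * D * |Γ|` gives `n ^ (1 / (h - 1)) ≤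
  -- B + B' * log |Γ|`. The summand `n₀` below covers those `n` for which the bound of `SESH` is not
  -- yet valid.
  obtain ⟨B, hB⟩ : ∃ B : ℕ, logb 2 (4 * D / K) / c ≤ B := exists_nat_ge _
  obtain ⟨B', hB'⟩ : ∃ B' : ℕ, 1 / c ≤ B' := exists_nat_ge _
  refine ⟨n₀ + (B + B') ^ (h - 1), fun Γ a hsol => ?_⟩
  have hpos : 0 < Γ.size := lt_of_le_of_lt (Nat.zero_le _) Γ.out₁_lt
  have hsize : 1 ≤ Γ.size.size := Nat.size_pos.2 hpos
  obtain ⟨x, hx, e, he⟩ := Γ.exists_maskedValue_iff a hsol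
  refine ⟨x, hx, ?_⟩
  have hle := Γ.card_support_le x
  generalize (Γ.support x).card = n at e he hle
  rcases lt_or_ge n n₀ with hn | hn
  · calc n ≤ (n₀ + (B + B') ^ (h - 1)) * 1 := by omega
      _ ≤ _ := Nat.mul_le_mul_left _ (Nat.one_le_pow _ _ hsize)
  obtain ⟨C, hC, hC'⟩ := exists_circuit_of_system hh' hp (Γ.maskedValue e x a)
    (Γ.maskedValue_mem_systemForms e x a) none
  rw [hD, Fintype.card_option, Fintype.card_fin] at hC
  have hAND := hn₀ n hn C fun y => (hC' y).trans (he y)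
  have hC₁ : (C.size : ℝ) ≤ 4 * D * Γ.size := by
    -- Uses `n ≤ |Γ|` and `1 ≤ |Γ|`; the system has one function for each gate and one for the
    -- equation.
    have : D * (n + (Γ.size + 1) + 1) ≤ 4 * D * Γ.size := by
      rw [mul_comm 4 D, mul_assoc]
      exact Nat.mul_le_mul_left _ (by omega)
    exact_mod_cast hC.trans this
  have hexp : (2 : ℝ) ^ (c * (n : ℝ) ^ (1 / ((h : ℝ) - 1))) ≤ 4 * D / K * Γ.size := by
    rw [div_mul_eq_mul_div, le_div_iff₀ hK, mul_comm _ K]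
    exact hAND.trans hC₁
  have hDK : (0 : ℝ) < 4 * D / K := by positivity
  have hΓ : (0 : ℝ) < Γ.size := by exact_mod_cast hpos
  have hlog := Real.logb_le_logb_of_le (b := 2) one_lt_two (by positivity) hexp
  rw [Real.logb_rpow two_pos (by norm_num), Real.logb_mul hDK.ne' hΓ.ne'] at hlog
  have hlogΓ : logb 2 Γ.size ≤ Γ.size.size := by
    rw [Real.logb_le_iff_le_rpow one_lt_two hΓ, Real.rpow_natCast]
    exact_mod_cast (Nat.lt_size_self _).le
  have hroot : (n : ℝ) ^ (1 / ((h : ℝ) - 1)) ≤ (((B + B') * Γ.size.size : ℕ) : ℝ) := by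
    have h₁ : (n : ℝ) ^ (1 / ((h : ℝ) - 1)) ≤ logb 2 (4 * D / K) / c + Γ.size.size * (1 / c) := by
      rw [mul_one_div, ← add_div, le_div_iff₀ hc, mul_comm]
      linarith
    have h₂ : (Γ.size.size : ℝ) * (1 / c) ≤ Γ.size.size * B' := by gcongr
    have h₃ : (B : ℝ) ≤ B * Γ.size.size := by
      have : (1 : ℝ) ≤ Γ.size.size := by exact_mod_cast hsize
      nlinarith [(Nat.cast_nonneg B : (0 : ℝ) ≤ B)]
    push_cast
    linarith
  have hh₁ : (0 : ℝ) < (h : ℝ) - 1 := by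
    have : (1 : ℝ) < h := by exact_mod_cast hh'
    linarith
  have hn' : (n : ℝ) ≤ (((B + B') * Γ.size.size : ℕ) : ℝ) ^ (h - 1) := by
    have h₁ := Real.rpow_le_rpow (by positivity) hroot hh₁.le
    rw [← Real.rpow_mul (by positivity), one_div, inv_mul_cancel₀ hh₁.ne', Real.rpow_one] at h₁
    rwa [show (h : ℝ) - 1 = ((h - 1 : ℕ) : ℝ) by push_cast [hh]; ring, Real.rpow_natCast] at h₁
  have hn'' : n ≤ ((B + B') * Γ.size.size) ^ (h - 1) := by exact_mod_cast hn'
  rw [mul_pow] at hn''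
  exact hn''.trans (Nat.mul_le_mul_right _ (Nat.le_add_left _ _))

end DCircuit

/-! ### Structured programs and the stack machines that execute them -/

open Turing Function

/-- Programs over a family of stacks with alphabets `Γ`, returning a value of a finite type. -/
inductive Prog {K : Type} (Γ : K → Type) : Type → Type 1
  | ret {α : Type} (a : α) : Prog Γ α
  | push {α : Type} (k : K) (x : Γ k) (P : Prog Γ α) : Prog Γ α
  | pop {α : Type} (k : K) (f : Option (Γ k) → Prog Γ α) : Prog Γ α
  | bind {α β : Type} [Finite α] (P : Prog Γ α) (f : α → Prog Γ β) : Prog Γ β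
  | loop {α β : Type} [Finite α] (f : α → Prog Γ (α ⊕ β)) (a : α) : Prog Γ β

namespace Prog

variable {K : Type} {Γ : K → Type} {α β : Type}

/-- The labels of the machine that executes a program. -/
def Lab : {α : Type} → Prog Γ α → Type
  | _, ret _ => Unit
  | _, push _ _ P => Option P.Lab
  | _, pop _ f => Option (Σ o, (f o).Lab)
  | _, bind P f => P.Lab ⊕ Σ a, (f a).Lab
  | _, loop f _ => Σ a, (f a).Lab

theorem finite_lab [∀ k, Finite (Γ k)] : {α : Type} → (P : Prog Γ α) → Finite P.Lab
  | _, ret _ => inferInstanceAs (Finite Unit)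
  | _, push _ _ P => have := finite_lab P; inferInstanceAs (Finite (Option P.Lab))
  | _, pop _ f => have := fun o => finite_lab (f o)
    inferInstanceAs (Finite (Option (Σ o, (f o).Lab)))
  | _, bind P f => have := finite_lab P; have := fun o => finite_lab (f o)
    inferInstanceAs (Finite (P.Lab ⊕ Σ a, (f a).Lab))
  | _, loop f _ => have := fun o => finite_lab (f o)
    inferInstanceAs (Finite (Σ a, (f a).Lab))

/-- The label at which the execution of a program starts. -/
def entry : {α : Type} → (P : Prog Γ α) → P.Lab
  | _, ret _ => ()
  | _, push _ _ _ => none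
  | _, pop _ _ => none
  | _, bind P _ => Sum.inl P.entry
  | _, loop f a => ⟨a, (f a).entry⟩

/-- The register of the machine: the last symbol taken from a stack. -/
abbrev Reg (Γ : K → Type) : Type := Option (Σ k, Γ k)

variable [DecidableEq K]

/-- The symbol in the register, if it came from the stack `k`. -/
def Reg.get (k : K) : Reg Γ → Option (Γ k)
  | none => none
  | some ⟨k', x⟩ => if h : k' = k then some (h ▸ x) else none

theorem Reg.get_map (k : K) (o : Option (Γ k)) :
    Reg.get k (o.map (Sigma.mk k)) = o := by
  cases o <;> simp [Reg.get]

/-- The statements of the machine that executes a program, when its labels are embedded by `emb` and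
the control goes to `exit a` after the value `a` is returned. -/
def code {Λ : Type} : {α : Type} → (P : Prog Γ α) → (P.Lab → Λ) → (α → Λ) → P.Lab →
    TM2.Stmt Γ Λ (Reg Γ)
  | _, ret a, _, exit, _ => .goto fun _ => exit a
  | _, push k x P, emb, exit, l => match l with
    | none => .push k (fun _ => x) (.goto fun _ => emb (some P.entry))
    | some l => P.code (fun l => emb (some l)) exit l
  | _, pop k f, emb, exit, l => match l with
    | none => .pop k (fun _ o => o.map (Sigma.mk k))
        (.goto fun r => emb (some ⟨r.get k, (f (r.get k)).entry⟩))
    | some ⟨o, l⟩ => (f o).code (fun l => emb (some ⟨o, l⟩)) exit l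
  | _, bind P f, emb, exit, l => match l with
    | Sum.inl l => P.code (fun l => emb (Sum.inl l)) (fun a => emb (Sum.inr ⟨a, (f a).entry⟩)) l
    | Sum.inr ⟨a, l⟩ => (f a).code (fun l => emb (Sum.inr ⟨a, l⟩)) exit l
  | _, loop f _, emb, exit, l => match l with
    | ⟨a, l⟩ => (f a).code (fun l => emb ⟨a, l⟩)
        (Sum.elim (fun a => emb ⟨a, (f a).entry⟩) exit) l

/-- Started with the stacks `S`, the program `P` returns `a` with the stacks `S'` after at most `t`
steps of any machine that contains it. -/
def Runs (P : Prog Γ α) (S : ∀ k, List (Γ k)) (t : ℕ) (a : α) (S' : ∀ k, List (Γ k)) : Prop :=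
  ∀ (Λ : Type) (m : Λ → TM2.Stmt Γ Λ (Reg Γ)) (emb : P.Lab → Λ) (exit : α → Λ),
    (∀ l, m (emb l) = P.code emb exit l) → ∀ r : Reg Γ, ∃ r' : Reg Γ, ∃ n ≤ t,
      (flip Option.bind (TM2.step m))^[n] (some ⟨some (emb P.entry), r, S⟩) =
        some ⟨some (exit a), r', S'⟩

variable {S S₁ S' : ∀ k, List (Γ k)} {t t' : ℕ}

theorem Runs.mono {P : Prog Γ α} {a : α} (h : Runs P S t a S') (ht : t ≤ t') :
    Runs P S t' a S' := fun Λ m emb exit hm r => by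
  obtain ⟨r', n, hn, h⟩ := h Λ m emb exit hm r
  exact ⟨r', n, hn.trans ht, h⟩

theorem runs_ret (a : α) : Runs (ret a : Prog Γ α) S 1 a S := fun Λ m emb exit hm r =>
  ⟨r, 1, le_rfl, by simp [flip, hm, code]⟩

theorem runs_push {k : K} {x : Γ k} {P : Prog Γ α} {a : α}
    (h : Runs P (update S k (x :: S k)) t a S') : Runs (push k x P) S (t + 1) a S' :=
  fun Λ m emb exit hm r => by
  obtain ⟨r', n, hn, h⟩ := h Λ m (fun l => emb (some l)) exit (fun l => hm (some l)) r
  refine ⟨r', n + 1, by omega, ?_⟩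
  have h₀ : m (emb none) = _ := hm none
  rw [← h]
  simp [flip, h₀, code, entry]

theorem runs_pop {k : K} {f : Option (Γ k) → Prog Γ α} {a : α}
    (h : Runs (f (S k).head?) (update S k (S k).tail) t a S') :
    Runs (pop k f) S (t + 1) a S' := fun Λ m emb exit hm r => by
  obtain ⟨r', n, hn, h⟩ := h Λ m (fun l => emb (some ⟨_, l⟩)) exit (fun l => hm (some ⟨_, l⟩))
    ((S k).head?.map (Sigma.mk k))
  refine ⟨r', n + 1, by omega, ?_⟩
  have h₀ : m (emb none) = _ := hm none
  rw [← h]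
  simp only [iterate_succ_apply, flip, Option.bind_some, entry, TM2.step, h₀, code, TM2.stepAux]
  rw [show Reg.get k (Option.map (Sigma.mk k) (S k).head?) = _ from Reg.get_map k _]

/-- `Runs` quantifies over all machines that contain the code, with arbitrary labels and exits. So
each part can be run inside the machine of the whole program, the exit of `P` being the entry of `f
a`. -/
theorem runs_bind [Finite α] {P : Prog Γ α} {f : α → Prog Γ β} {a : α} {b : β}
    (h : Runs P S t a S₁) (h' : Runs (f a) S₁ t' b S') :
    Runs (bind P f) S (t + t') b S' := fun Λ m emb exit hm r => by
  obtain ⟨r₁, n, hn, h⟩ := h Λ m (fun l => emb (Sum.inl l)) _ (fun l => hm (Sum.inl l)) r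
  obtain ⟨r', n', hn', h'⟩ := h' Λ m (fun l => emb (Sum.inr ⟨a, l⟩)) exit
    (fun l => hm (Sum.inr ⟨a, l⟩)) r₁
  refine ⟨r', n' + n, by omega, ?_⟩
  rw [iterate_add_apply, ← h']
  exact congrArg _ h

/-- The labels and the code of a loop do not depend on its initial state, only the entry does; so
`loop f a` and `loop f a'` run in the same machine through the same embedding. -/
theorem runs_loop_continue [Finite α] {f : α → Prog Γ (α ⊕ β)} {a a' : α} {b : β}
    (h : Runs (f a) S t (Sum.inl a') S₁) (h' : Runs (loop f a') S₁ t' b S') :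
    Runs (loop f a) S (t + t') b S' := fun Λ m emb exit hm r => by
  obtain ⟨r₁, n, hn, h⟩ := h Λ m (fun l => emb ⟨a, l⟩) _ (fun l => hm ⟨a, l⟩) r
  obtain ⟨r', n', hn', h'⟩ := h' Λ m emb exit hm r₁
  refine ⟨r', n' + n, by omega, ?_⟩
  rw [iterate_add_apply, ← h']
  exact congrArg _ h

theorem runs_loop_exit [Finite α] {f : α → Prog Γ (α ⊕ β)} {a : α} {b : β}
    (h : Runs (f a) S t (Sum.inr b) S') :
    Runs (loop f a) S t b S' := fun Λ m emb _ hm r =>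
  h Λ m (fun l => emb ⟨a, l⟩) _ (fun l => hm ⟨a, l⟩) r

/-- The machine that executes a program and halts. -/
noncomputable def machine [Fintype K] [∀ k, Fintype (Γ k)] (k₀ k₁ : K) (P : Prog Γ Unit) :
    FinTM2 :=
  have := finite_lab P
  { K := K
    k₀ := k₀
    k₁ := k₁
    Γ := Γ
    Λ := Option P.Lab
    main := some P.entry
    ΛFin := Fintype.ofFinite _
    σ := Reg Γ
    initialState := none
    m := fun l => match l with
      -- The final configuration required by `TM2OutputsInTime` has the register in its initial
      -- state, so it is cleared before halting. This costs the additional step in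
      -- `outputsInTime_machine`.
      | none => .load (fun _ => none) .halt
      | some l => P.code some (fun _ => none) l }

theorem outputsInTime_machine [Fintype K] [∀ k, Fintype (Γ k)] {k₀ k₁ : K} {P : Prog Γ Unit}
    {l : List (Γ k₀)} {l' : List (Γ k₁)}
    (h : Runs P (update (fun _ => []) k₀ l) t () (update (fun _ => []) k₁ l')) :
    Nonempty (TM2OutputsInTime (machine k₀ k₁ P) l (some l') (t + 1)) := by
  obtain ⟨r, n, hn, h⟩ := h (Option P.Lab) (machine k₀ k₁ P).m some (fun _ => none)
    (fun l => rfl) none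
  have upd : ∀ (k : K) (l : List (Γ k)), (fun k' => @dite (List (Γ k')) (k' = k) _
      (fun h => by rw [h]; exact l) fun _ => []) = update (fun _ => []) k l := by
    intro k l
    funext k'
    by_cases hk : k' = k
    · subst hk; simp
    · simp [hk]
  refine ⟨⟨⟨n + 1, ?_⟩, Nat.add_le_add_right hn 1⟩⟩
  have h₀ : initList (machine k₀ k₁ P) l = ⟨some (some P.entry), none, update (fun _ => []) k₀ l⟩ :=
    congrArg (TM2.Cfg.mk (some (some P.entry)) none) (upd k₀ l)
  have h₁ : haltList (machine k₀ k₁ P) l' = ⟨none, none, update (fun _ => []) k₁ l'⟩ :=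
    congrArg (TM2.Cfg.mk none none) (upd k₁ l')
  have h₂ := congrArg (flip Option.bind (TM2.step (machine k₀ k₁ P).m)) h
  replace h₂ := (iterate_succ_apply' _ n _).trans h₂
  exact (congrArg (fun c => (flip Option.bind (TM2.step (machine k₀ k₁ P).m))^[n + 1] (some c))
    h₀).trans (h₂.trans (congrArg some h₁.symm))

end Prog

/-! ### The stacks of the search machine and its programs -/

/-- The stacks of the search machine: the unread and the read part of the input, the values of the
gates that were passed and of the other ones, the unread and the read part of the candidate
valuation, the budget of nonzero digits, a unary logarithm, two auxiliary counters and the output. -/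
inductive Stk | I | J | V | W | X | Y | R | L | M | N | O
  deriving DecidableEq

instance : Fintype Stk where
  elems := {.I, .J, .V, .W, .X, .Y, .R, .L, .M, .N, .O}
  complete k := by cases k <;> decide

/-- The alphabets of the stacks. Values of input gates are written as digits `0, …, q`. -/
abbrev StkSym {h : ℕ} (p : Fin h → ℕ) (q : ℕ) : Stk → Type
  | .I | .J => DSym p
  | .V | .W => DAlg p
  | .X | .Y => Fin (q + 1)
  | .R | .L | .M | .N => Unit
  | .O => Bool

/-- The contents of all stacks. -/
structure Store {h : ℕ} (p : Fin h → ℕ) (q : ℕ) where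
  I : List (DSym p) := []
  J : List (DSym p) := []
  V : List (DAlg p) := []
  W : List (DAlg p) := []
  X : List (Fin (q + 1)) := []
  Y : List (Fin (q + 1)) := []
  R : List Unit := []
  L : List Unit := []
  M : List Unit := []
  N : List Unit := []
  O : List Bool := []

namespace Store

variable {h : ℕ} {p : Fin h → ℕ} {q : ℕ}

/-- The content of a stack. -/
def get (s : Store p q) : ∀ k, List (StkSym p q k)
  | .I => s.I
  | .J => s.J
  | .V => s.V
  | .W => s.W
  | .X => s.X
  | .Y => s.Y
  | .R => s.R
  | .L => s.L
  | .M => s.M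
  | .N => s.N
  | .O => s.O

/-- Replace the content of a stack. -/
def set (s : Store p q) : ∀ k, List (StkSym p q k) → Store p q
  | .I, l => { s with I := l }
  | .J, l => { s with J := l }
  | .V, l => { s with V := l }
  | .W, l => { s with W := l }
  | .X, l => { s with X := l }
  | .Y, l => { s with Y := l }
  | .R, l => { s with R := l }
  | .L, l => { s with L := l }
  | .M, l => { s with M := l }
  | .N, l => { s with N := l }
  | .O, l => { s with O := l }

theorem update_get (s : Store p q) (k : Stk) (l : List (StkSym p q k)) :
    update s.get k l = (s.set k l).get := by
  funext k'
  cases k <;> cases k' <;> simp [update, get, set]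

theorem get_set_self (s : Store p q) (k : Stk) (l : List (StkSym p q k)) :
    (s.set k l).get k = l := by
  cases k <;> rfl

theorem get_set_of_ne (s : Store p q) {k k' : Stk} (hk : k' ≠ k) (l : List (StkSym p q k)) :
    (s.set k l).get k' = s.get k' := by
  rw [← update_get, update_of_ne hk]

theorem set_set (s : Store p q) (k : Stk) (l l' : List (StkSym p q k)) :
    (s.set k l).set k l' = s.set k l' := by
  cases k <;> rfl

theorem set_comm (s : Store p q) {k k' : Stk} (hk : k ≠ k') (l : List (StkSym p q k))
    (l' : List (StkSym p q k')) : (s.set k l).set k' l' = (s.set k' l').set k l := by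
  cases k <;> cases k' <;> first | rfl | exact absurd rfl hk

theorem set_get (s : Store p q) (k : Stk) : s.set k (s.get k) = s := by
  cases k <;> rfl

end Store

open Prog

/-- Programs of the search machine. -/
abbrev SProg {h : ℕ} (p : Fin h → ℕ) (q : ℕ) (α : Type) : Type 1 := Prog (StkSym p q) α

namespace SProg

variable {h : ℕ} {p : Fin h → ℕ} {q : ℕ} {α β : Type}

/-- `Prog.Runs` for contents of stacks that are given by records. -/
def Exec (P : SProg p q α) (s : Store p q) (t : ℕ) (a : α) (s' : Store p q) : Prop :=
  Runs P s.get t a s'.get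

variable {s s₁ s' : Store p q} {t t' : ℕ}

theorem Exec.mono {P : SProg p q α} {a : α} (h : Exec P s t a s') (ht : t ≤ t') :
    Exec P s t' a s' := Runs.mono h ht

theorem Exec.of_eq {P : SProg p q α} {a : α} (h : Exec P s t a s₁) (ht : t ≤ t') (hs : s₁ = s') :
    Exec P s t' a s' := hs ▸ h.mono ht

theorem exec_ret (a : α) : Exec (ret a : SProg p q α) s 1 a s := runs_ret a

theorem exec_push {k : Stk} {x : StkSym p q k} {P : SProg p q α} {a : α}
    (h : Exec P (s.set k (x :: s.get k)) t a s') : Exec (push k x P) s (t + 1) a s' :=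
  runs_push (by rwa [Store.update_get])

theorem exec_pop {k : Stk} {f : Option (StkSym p q k) → SProg p q α} {a : α}
    (h : Exec (f (s.get k).head?) (s.set k (s.get k).tail) t a s') :
    Exec (pop k f) s (t + 1) a s' :=
  runs_pop (by rwa [Store.update_get])

theorem exec_bind [Finite α] {P : SProg p q α} {f : α → SProg p q β} {a : α} {b : β}
    (h : Exec P s t a s₁) (h' : Exec (f a) s₁ t' b s') : Exec (bind P f) s (t + t') b s' :=
  runs_bind h h'

theorem exec_loop_continue [Finite α] {f : α → SProg p q (α ⊕ β)} {a a' : α} {b : β}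
    (h : Exec (f a) s t (Sum.inl a') s₁) (h' : Exec (loop f a') s₁ t' b s') :
    Exec (loop f a) s (t + t') b s' := runs_loop_continue h h'

theorem exec_loop_exit [Finite α] {f : α → SProg p q (α ⊕ β)} {a : α} {b : β}
    (h : Exec (f a) s t (Sum.inr b) s') : Exec (loop f a) s t b s' := runs_loop_exit h

/-! ### Elementary programs -/

/-- A loop without data. -/
abbrev while_ (P : SProg p q (Unit ⊕ β)) : SProg p q β := loop (fun _ => P) ()

/-- Continue a loop. -/
abbrev next : SProg p q (Unit ⊕ β) := ret (Sum.inl ())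

/-- Leave a loop. -/
abbrev done (b : β) : SProg p q (Unit ⊕ β) := ret (Sum.inr b)

/-- Move the content of a stack to another one. -/
def move (k k' : Stk) (f : StkSym p q k → StkSym p q k') : SProg p q Unit :=
  while_ (pop k fun o => match o with
    | none => done ()
    | some x => push k' (f x) next)

theorem exec_move {k k' : Stk} (hk : k ≠ k') (f : StkSym p q k → StkSym p q k') :
    Exec (move k k' f) s (3 * (s.get k).length + 2) ()
      ((s.set k []).set k' (((s.get k).map f).reverse ++ s.get k')) := by
  generalize hl : s.get k = l
  induction l generalizing s with
  | nil =>
    have : (s.set k []).set k' (s.get k') = s := by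
      rw [Store.set_comm _ hk, Store.set_get, ← hl, Store.set_get]
    refine exec_loop_exit (exec_pop ?_)
    simp only [hl, List.head?_nil, List.tail_nil, List.map_nil, List.reverse_nil, List.nil_append,
      this]
    rw [← hl, Store.set_get]
    exact (exec_ret _).mono (by omega)
  | cons x l ih =>
    refine (exec_loop_continue (t := 3) (t' := 3 * l.length + 2) (a' := ())
      (s₁ := (s.set k l).set k' (f x :: s.get k')) (exec_pop ?_) ?_).mono ?_
    · simp only [hl, List.head?_cons, List.tail_cons]
      convert! exec_push (exec_ret _) using 3
      rw [Store.get_set_of_ne _ hk.symm]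
    · have h₁ : ((s.set k l).set k' (f x :: s.get k')).get k = l := by
        rw [Store.get_set_of_ne _ hk, Store.get_set_self]
      convert! ih h₁ using 1
      rw [Store.get_set_self, Store.set_comm _ hk.symm, Store.set_set, Store.set_set]
      simp
    · simp only [List.length_cons]; omega

/-- Empty a stack. -/
def clear (k : Stk) : SProg p q Unit :=
  while_ (pop k fun o => match o with
    | none => done ()
    | some _ => next)

theorem exec_clear {k : Stk} : Exec (clear k) s (2 * (s.get k).length + 2) () (s.set k []) := by
  generalize hl : s.get k = l
  induction l generalizing s with
  | nil =>
    refine exec_loop_exit (exec_pop ?_)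
    simp only [hl, List.head?_nil, List.tail_nil]
    exact exec_ret _
  | cons x l ih =>
    refine (exec_loop_continue (t := 2) (t' := 2 * l.length + 2) (a' := ())
      (s₁ := s.set k l) (exec_pop ?_) ?_).mono ?_
    · simp only [hl, List.head?_cons, List.tail_cons]
      exact exec_ret _
    · have := ih (Store.get_set_self s k l)
      rwa [Store.set_set] at this
    · simp only [List.length_cons]; omega

/-! ### Evaluation of a circuit -/

/-- Pass as many values as the number that is read says. -/
def walk : SProg p q Unit :=
  while_ (pop .I fun o => match o with
    | none => done ()
    | some x => push .J x (match x with
      | .tick => pop .W fun o => match o with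
        | none => next
        | some d => push .V d next
      | _ => done ()))

/-- The values that were passed lie on `V` in reversed order, so moving `V` back restores `W`; the
number that was read is kept on `J`, from which the input is restored later. -/
theorem exec_walk (a : ℕ) (l : List (DSym p)) (hI : s.I = DSym.encodeNum a ++ l) :
    Exec walk s (5 * a + 3) () { s with
      I := l
      J := (DSym.encodeNum a).reverse ++ s.J
      V := (s.W.take a).reverse ++ s.V
      W := s.W.drop a } := by
  induction a generalizing s with
  | zero =>
    refine exec_loop_exit (exec_pop (t := 2) ?_)
    simp only [Store.get, Store.set, hI, DSym.encodeNum, List.replicate_zero, List.nil_append,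
      List.cons_append, List.head?_cons, List.tail_cons]
    exact exec_push (exec_ret _)
  | succ a ih =>
    have hI' : s.I = DSym.tick :: (DSym.encodeNum a ++ l) := by
      rw [hI]; simp [DSym.encodeNum, List.replicate_succ]
    refine (exec_loop_continue (t := 5) (t' := 5 * a + 3) (a' := ()) (s₁ := { s with
        I := DSym.encodeNum a ++ l
        J := .tick :: s.J
        V := (s.W.take 1).reverse ++ s.V
        W := s.W.drop 1 }) (exec_pop ?_) ?_).mono (by omega)
    · simp only [Store.get, Store.set, hI', List.head?_cons, List.tail_cons]
      refine exec_push (exec_pop ?_)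
      simp only [Store.get, Store.set]
      rcases s.W with _ | ⟨d, W⟩
      · exact (exec_ret _).mono (by omega)
      · exact exec_push (exec_ret _)
    · refine (ih (s := { s with
        I := DSym.encodeNum a ++ l
        J := .tick :: s.J
        V := (s.W.take 1).reverse ++ s.V
        W := s.W.drop 1 }) rfl).of_eq le_rfl ?_
      rcases s.W with _ | ⟨d, W⟩ <;> simp [DSym.encodeNum, List.replicate_succ]

/-- Read a number and look up the value of the gate with that number. -/
def lookup : SProg p q (DAlg p) :=
  bind walk fun _ => pop .W fun o => match o with
    | none => bind (move .V .W id) fun _ => ret 0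
    | some d => push .W d (bind (move .V .W id) fun _ => ret d)

theorem exec_lookup [Finite (DAlg p)] (a : ℕ) (l : List (DSym p)) (hI : s.I = DSym.encodeNum a ++ l)
    (hV : s.V = []) : Exec lookup s (8 * a + 8) (s.W.getD a 0) { s with
      I := l
      J := (DSym.encodeNum a).reverse ++ s.J } := by
  refine (exec_bind (exec_walk a l hI) (t' := 3 * a + 5) (exec_pop ?_)).mono (by omega)
  have key : ∀ d : DAlg p, Exec (bind (move .V .W id) fun _ => ret d) { s with
      I := l
      J := (DSym.encodeNum a).reverse ++ s.J
      V := (s.W.take a).reverse ++ s.V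
      W := s.W.drop a } (3 * a + 3) d { s with
      I := l
      J := (DSym.encodeNum a).reverse ++ s.J } := by
    intro d
    refine (exec_bind (t' := 1) (exec_move (by decide) _) (?_ : Exec _ _ _ d _)).mono ?_
    · convert! exec_ret d using 1
      simp [Store.get, Store.set, hV]
    · simp [Store.get, hV]
  simp only [Store.get, Store.set]
  by_cases ha : a < s.W.length
  · have h₁ : (s.W.drop a).head? = some (s.W.getD a 0) := by
      simp [List.head?_drop, ha]
    rw [h₁]
    refine (exec_push ?_)
    convert! key _ using 1
    simp only [Store.get, Store.set]
    congr 1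
    rw [List.cons_eq_cons.2 ⟨rfl, rfl⟩]
    rw [List.drop_eq_getElem_cons ha]
    simp [ha]
  -- A number beyond the end of the list yields `0`, the default value of `getD` in `DGate.value`.
  · have h₁ : s.W.drop a = [] := by simpa using ha
    have h₂ : s.W.getD a 0 = 0 := by simp [List.getD, not_lt.1 ha]
    have := key 0
    simp only [h₁, h₂, List.head?_nil, List.tail_nil] at this ⊢
    exact this.mono (by omega)

/-- Append a value to the values of the gates. -/
def append (d : DAlg p) : SProg p q Unit :=
  bind (move .W .V id) fun _ => push .V d (move .V .W id)

theorem exec_append (d : DAlg p) (hV : s.V = []) :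
    Exec (append d) s (6 * s.W.length + 8) () { s with W := s.W ++ [d] } := by
  refine (exec_bind (exec_move (by decide) _) (t' := 3 * s.W.length + 6) (exec_push ?_)).mono ?_
  · refine (exec_move (k := .V) (k' := .W) (by decide) id).of_eq ?_ ?_
    · simp [Store.get, Store.set, hV]; omega
    · simp [Store.get, Store.set, hV]
  · simp [Store.get]; omega

end SProg

/-- Whether a gate is an input gate. -/
def DGate.isInput {h : ℕ} {p : Fin h → ℕ} : DGate p → Bool
  | input => true
  | _ => false

/-- The values of all gates, when the values of the previous gates are `vals` and the values of the
input gates are listed by `xs`. -/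
def DGate.evalList {h : ℕ} {p : Fin h → ℕ} {q : ℕ} (dec : Fin (q + 1) → DAlg p) :
    List (DGate p) → List (DAlg p) → List (Fin (q + 1)) → List (DAlg p)
  | [], vals, _ => vals
  | g :: gs, vals, xs => evalList dec gs (vals ++ [g.value vals (dec (xs.headD 0))])
      (if g.isInput then xs.tail else xs)

namespace SProg

variable {h : ℕ} {p : Fin h → ℕ} {q : ℕ} {α β : Type} {s s₁ s' : Store p q} {t t' : ℕ}

/-- Read the gates one by one and compute their values, then compare the values of the two output
gates. -/
def evalGates (dec : Fin (q + 1) → DAlg p) [Finite (DAlg p)] [DecidableEq (DAlg p)] :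
    SProg p q Bool :=
  while_ (pop .I fun o => match o with
    | none => done false
    | some x => push .J x (match x with
      | .input => pop .X fun o => match o with
        | none => bind (append (dec 0)) fun _ => next
        | some d => push .Y d (bind (append (dec d)) fun _ => next)
      | .const d => bind (append d) fun _ => next
      | .add => bind lookup fun a => bind lookup fun b => bind (append (a + b)) fun _ => next
      | .neg => bind lookup fun a => bind (append (-a)) fun _ => next
      | .e j => bind lookup fun a => bind (append (DAlg.e j a)) fun _ => next
      | .v j => bind lookup fun a => bind (append (DAlg.v j a)) fun _ => next
      | .out => bind lookup fun a => bind lookup fun b => done (decide (a = b))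
      | _ => done false))

/-- The store after a gate was read and evaluated. -/
def afterGate (dec : Fin (q + 1) → DAlg p) (s : Store p q) (g : DGate p) (l : List (DSym p)) :
    Store p q :=
  { s with
    I := l
    J := (DSym.encodeGate g).reverse ++ s.J
    W := s.W ++ [g.value s.W (dec (s.X.headD 0))]
    X := if g.isInput then s.X.tail else s.X
    Y := if g.isInput then (s.X.take 1).reverse ++ s.Y else s.Y }

/-- The summand linear in the length of the code pays for looking up arguments, the one in
`s.W.length` for appending the new value at the bottom of the stack. -/
theorem exec_evalGates_step (dec : Fin (q + 1) → DAlg p) [Finite (DAlg p)] [DecidableEq (DAlg p)]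
    (g : DGate p) (l : List (DSym p)) {t' : ℕ} {b : Bool}
    (hI : s.I = DSym.encodeGate g ++ l) (hV : s.V = [])
    (h : Exec (evalGates dec) (afterGate dec s g l) t' b s') :
    Exec (evalGates dec) s (8 * (DSym.encodeGate g).length + 6 * s.W.length + 30 + t') b s' := by
  refine exec_loop_continue (s₁ := afterGate dec s g l) (a' := ()) ?_ h
  unfold afterGate
  cases g with
  | input =>
    refine (exec_pop (t := 6 * s.W.length + 20) ?_).mono (by omega)
    simp only [DSym.encodeGate, List.cons_append, List.nil_append] at hI
    simp only [Store.get, Store.set, hI, List.head?_cons, List.tail_cons]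
    refine (exec_push (exec_pop (t := 6 * s.W.length + 16) ?_)).mono (by omega)
    simp only [Store.get, Store.set]
    rcases hX : s.X with _ | ⟨d, X⟩
    · simp only [List.head?_nil]
      refine Exec.of_eq (exec_bind (exec_append _ hV) (exec_ret _)) (by simp) ?_
      simp [DSym.encodeGate, DGate.value, DGate.isInput]
    · simp only [List.head?_cons]
      refine (exec_push (t := 6 * s.W.length + 15) ?_).mono (by omega)
      simp only [Store.get, Store.set]
      refine Exec.of_eq (exec_bind (exec_append _ hV) (exec_ret _)) (by simp) ?_
      simp [DSym.encodeGate, DGate.value, DGate.isInput]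
  | const d =>
    refine (exec_pop (t := 6 * s.W.length + 20) ?_).mono (by omega)
    simp only [DSym.encodeGate, List.cons_append, List.nil_append] at hI
    simp only [Store.get, Store.set, hI, List.head?_cons, List.tail_cons]
    refine (exec_push (t := 6 * s.W.length + 16) ?_).mono (by omega)
    simp only [Store.get, Store.set]
    refine Exec.of_eq (exec_bind (exec_append _ hV) (exec_ret _)) (by simp) ?_
    simp [DSym.encodeGate, DGate.value, DGate.isInput]
  | add a b =>
    simp only [DSym.encodeGate, List.cons_append, List.append_assoc] at hI
    refine exec_pop (t := 8 * a + 8 * b + 6 * s.W.length + 27) ?_ |>.mono ?_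
    · simp only [Store.get, Store.set, hI, List.head?_cons, List.tail_cons]
      refine (exec_push (t := 8 * a + 8 * b + 6 * s.W.length + 26) ?_)
      simp only [Store.get, Store.set]
      refine Exec.of_eq (exec_bind (exec_lookup a _ rfl hV) (exec_bind (exec_lookup b _ rfl hV)
        (exec_bind (exec_append _ hV) (exec_ret _)))) (by simp only []; omega) ?_
      simp [DSym.encodeGate, DGate.value, DGate.isInput]
    · simp [DSym.encodeGate, DSym.encodeNum]; omega
  | neg a =>
    simp only [DSym.encodeGate, List.cons_append] at hI
    refine exec_pop (t := 8 * a + 6 * s.W.length + 19) ?_ |>.mono ?_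
    · simp only [Store.get, Store.set, hI, List.head?_cons, List.tail_cons]
      refine (exec_push (t := 8 * a + 6 * s.W.length + 18) ?_)
      simp only [Store.get, Store.set]
      refine Exec.of_eq (exec_bind (exec_lookup a _ rfl hV)
        (exec_bind (exec_append _ hV) (exec_ret _))) (by simp only []; omega) ?_
      simp [DSym.encodeGate, DGate.value, DGate.isInput]
    · simp [DSym.encodeGate, DSym.encodeNum]; omega
  | e j a =>
    simp only [DSym.encodeGate, List.cons_append] at hI
    refine exec_pop (t := 8 * a + 6 * s.W.length + 19) ?_ |>.mono ?_
    · simp only [Store.get, Store.set, hI, List.head?_cons, List.tail_cons]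
      refine (exec_push (t := 8 * a + 6 * s.W.length + 18) ?_)
      simp only [Store.get, Store.set]
      refine Exec.of_eq (exec_bind (exec_lookup a _ rfl hV)
        (exec_bind (exec_append _ hV) (exec_ret _))) (by simp only []; omega) ?_
      simp [DSym.encodeGate, DGate.value, DGate.isInput]
    · simp [DSym.encodeGate, DSym.encodeNum]; omega
  | v j a =>
    simp only [DSym.encodeGate, List.cons_append] at hI
    refine exec_pop (t := 8 * a + 6 * s.W.length + 19) ?_ |>.mono ?_
    · simp only [Store.get, Store.set, hI, List.head?_cons, List.tail_cons]
      refine (exec_push (t := 8 * a + 6 * s.W.length + 18) ?_)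
      simp only [Store.get, Store.set]
      refine Exec.of_eq (exec_bind (exec_lookup a _ rfl hV)
        (exec_bind (exec_append _ hV) (exec_ret _))) (by simp only []; omega) ?_
      simp [DSym.encodeGate, DGate.value, DGate.isInput]
    · simp [DSym.encodeGate, DSym.encodeNum]; omega

theorem length_encodeGate_pos (g : DGate p) : 0 < (DSym.encodeGate g).length := by
  cases g <;> simp [DSym.encodeGate]

theorem length_evalList (dec : Fin (q + 1) → DAlg p) (gs : List (DGate p)) (vals : List (DAlg p))
    (xs : List (Fin (q + 1))) :
    (DGate.evalList dec gs vals xs).length = vals.length + gs.length := by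
  induction gs generalizing vals xs with
  | nil => rfl
  | cons g gs ih => rw [DGate.evalList, ih]; simp; omega

/-- Here `k` is the number of input gates that were read, each of which consumes a digit as long as
there is one. -/
theorem exec_evalGates (dec : Fin (q + 1) → DAlg p) [Finite (DAlg p)] [DecidableEq (DAlg p)]
    (gs : List (DGate p)) (o₁ o₂ n : ℕ) (hn : s.I.length + s.W.length ≤ n)
    (hI : s.I = gs.flatMap DSym.encodeGate ++
      DSym.out :: (DSym.encodeNum o₁ ++ DSym.encodeNum o₂)) (hV : s.V = []) :
    ∃ k, Exec (evalGates dec) s (20 * (n + 3) * (gs.length + 1))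
      (decide ((DGate.evalList dec gs s.W s.X).getD o₁ 0 =
        (DGate.evalList dec gs s.W s.X).getD o₂ 0))
      { s with
        I := []
        J := s.I.reverse ++ s.J
        W := DGate.evalList dec gs s.W s.X
        X := s.X.drop k
        Y := (s.X.take k).reverse ++ s.Y } := by
  induction gs generalizing s with
  | nil =>
    refine ⟨0, exec_loop_exit (Exec.mono (exec_pop (t := 8 * o₁ + 8 * o₂ + 18) ?_) ?_)⟩
    · simp only [List.flatMap_nil, List.nil_append] at hI
      simp only [Store.get, Store.set, hI, List.head?_cons, List.tail_cons]
      refine (exec_push (t := 8 * o₁ + 8 * o₂ + 17) ?_)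
      simp only [Store.get, Store.set]
      refine Exec.of_eq (exec_bind (exec_lookup o₁ _ rfl hV) (exec_bind
        (exec_lookup o₂ [] (List.append_nil _).symm hV) (exec_ret _))) (by omega) ?_
      simp [DGate.evalList]
    · rw [hI] at hn
      simp [DSym.encodeNum] at hn
      simp; omega
  | cons g gs ih =>
    have hpos := length_encodeGate_pos g
    rw [List.flatMap_cons, List.append_assoc] at hI
    have hlen := congrArg List.length hI
    rw [List.length_append] at hlen
    obtain ⟨k, hk⟩ := ih (s := afterGate dec s g _) (by
      simp only [afterGate, List.length_append, List.length_singleton] at hlen ⊢; omega) rfl hV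
    refine ⟨if g.isInput then k + 1 else k, ?_⟩
    refine ((exec_evalGates_step dec g _ hI hV hk).of_eq ?_ ?_)
    · simp only [List.length_cons]
      nlinarith
    · simp only [afterGate, DGate.evalList, hI]
      split_ifs
      · rcases s.X with _ | ⟨d, X⟩ <;> simp
      · simp

/-- Decide whether the two output gates have the same values under the candidate valuation. -/
def test (dec : Fin (q + 1) → DAlg p) [Finite (DAlg p)] [DecidableEq (DAlg p)] : SProg p q Bool :=
  bind (evalGates dec) fun b => bind (move .J .I id) fun _ => bind (move .Y .X id) fun _ =>
    bind (clear .W) fun _ => ret b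

/-- The test restores the whole store. This makes it reusable for the next candidate. -/
theorem exec_test (dec : Fin (q + 1) → DAlg p) [Finite (DAlg p)] [DecidableEq (DAlg p)]
    (Γ : DCircuit p) (n : ℕ) (hn : s.I.length + s.X.length ≤ n) (hn' : Γ.size ≤ n)
    (hI : s.I = DSym.encodeCircuit Γ) (hJ : s.J = []) (hV : s.V = []) (hW : s.W = [])
    (hY : s.Y = []) :
    Exec (test dec) s (30 * (n + 3) ^ 2)
      (decide ((DGate.evalList dec Γ.gates [] s.X).getD Γ.out₁ 0 =
        (DGate.evalList dec Γ.gates [] s.X).getD Γ.out₂ 0)) s := by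
  obtain ⟨k, hk⟩ := exec_evalGates dec Γ.gates Γ.out₁ Γ.out₂ n (s := s) (by simp [hW]; omega) hI hV
  rw [hW] at hk
  refine Exec.of_eq (exec_bind hk (exec_bind (exec_move (by decide) _)
    (exec_bind (exec_move (by decide) _) (exec_bind exec_clear (exec_ret _))))) ?_ ?_
  · have hs : Γ.gates.length ≤ n := hn'
    have h₁ : min k s.X.length ≤ s.X.length := min_le_right _ _
    simp [Store.get, Store.set, hJ, hY, length_evalList]
    nlinarith
  · simp [Store.get, Store.set, hJ, hY]
    cases s
    simp_all

end SProg

/-! ### Enumeration of sparse lists of digits -/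

namespace Sparse

variable {q : ℕ}

/-- The successor of a list of digits (the first one being the least significant) among the lists
with a bounded number of nonzero digits, where `r` counts how many more zeros may be changed; the
flag tells whether there is a successor. -/
def succ : List (Fin (q + 1)) → List Unit → Bool × List (Fin (q + 1)) × List Unit
  | [], r => (false, [], r)
  | d :: l, r =>
    if d = 0 then
      match r with
      | [] => ((succ l []).1, 0 :: (succ l []).2.1, (succ l []).2.2)
      | _ :: r => (true, 1 :: l, r)
    else if d = Fin.last q then
      ((succ l (() :: r)).1, 0 :: (succ l (() :: r)).2.1, (succ l (() :: r)).2.2)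
    else (true, (d + 1) :: l, r)

/-- The number of nonzero digits. -/
def weight (l : List (Fin (q + 1))) : ℕ := l.countP (· ≠ 0)

theorem length_succ (l : List (Fin (q + 1))) (r : List Unit) : (succ l r).2.1.length = l.length := by
  induction l generalizing r with
  | nil => rfl
  | cons d l ih =>
    unfold succ
    split_ifs
    · cases r <;> simp [ih]
    · simp [ih]
    · simp

@[simp] theorem weight_nil : weight ([] : List (Fin (q + 1))) = 0 := rfl

@[simp] theorem weight_cons (d : Fin (q + 1)) (l : List (Fin (q + 1))) :
    weight (d :: l) = weight l + if d = 0 then 0 else 1 := by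
  by_cases h : d = 0 <;> simp [weight, h]

theorem val_add_one (d : Fin (q + 1)) (h : d ≠ Fin.last q) : ((d + 1 : Fin (q + 1)) : ℕ) = d + 1 :=
  Fin.val_add_one_of_lt (Fin.lt_last_iff_ne_last.2 h)

theorem add_one_ne_zero (d : Fin (q + 1)) (h : d ≠ Fin.last q) : d + 1 ≠ 0 := fun h' => by
  have := val_add_one d h
  rw [h'] at this
  simp at this

theorem one_ne_zero_of_pos (hq : 0 < q) : (1 : Fin (q + 1)) ≠ 0 := by
  have := add_one_ne_zero (0 : Fin (q + 1)) (Fin.ne_of_val_ne (by simp; omega))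
  rwa [zero_add] at this

/-- A unit of the budget is spent when a zero becomes nonzero and returned when a digit is reset, so
weight plus budget is invariant and the weight never exceeds its initial bound. -/
theorem weight_succ (hq : 0 < q) (l : List (Fin (q + 1))) (r : List Unit) :
    weight (succ l r).2.1 + (succ l r).2.2.length = weight l + r.length := by
  induction l generalizing r with
  | nil => rfl
  | cons d l ih =>
    unfold succ
    split_ifs with h₁ h₂
    · cases r with
      | nil => simpa [h₁] using ih []
      | cons u r => simp [h₁, one_ne_zero_of_pos hq]; omega
    · have := ih (() :: r)
      simp [h₁] at this ⊢; omega
    · simp [h₁, add_one_ne_zero d h₂]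

/-- The number with the given digits. -/
def number : List (Fin (q + 1)) → ℕ
  | [] => 0
  | d :: l => d + (q + 1) * number l

/-- Strict growth shows that no list is visited twice; it yields termination and the bound for the
number of steps. -/
theorem number_lt_number_succ (hq : 0 < q) (l : List (Fin (q + 1))) (r : List Unit)
    (h : (succ l r).1 = true) : number l < number (succ l r).2.1 := by
  induction l generalizing r with
  | nil => simp [succ] at h
  | cons d l ih =>
    have hd := d.isLt
    unfold succ at h ⊢
    split_ifs at h ⊢ with h₁ h₂
    · subst h₁
      cases r with
      | nil =>
        have := ih _ h
        simp only [number] at this ⊢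
        have := Nat.mul_lt_mul_of_pos_left this (Nat.succ_pos q)
        simp; omega
      | cons u r =>
        simp only [number]
        have := val_add_one (0 : Fin (q + 1)) (Fin.ne_of_val_ne (by simp; omega))
        rw [zero_add] at this
        rw [this]
        simp
    · have := ih _ h
      simp only [number]
      have : (q + 1) * (number l + 1) ≤ (q + 1) * number (succ l (() :: r)).2.1 :=
        Nat.mul_le_mul_left _ this
      simp; nlinarith
    · simp only [number]
      rw [val_add_one d h₂]
      omega

/-- One step of the enumeration. -/
def Step (s s' : List (Fin (q + 1)) × List Unit) : Prop := succ s.1 s.2 = (true, s')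

open Relation

/-- The first increment spends a unit of the budget, the further ones are free. -/
theorem reach_digit (hq : 0 < q) (l : List (Fin (q + 1))) (r : List Unit) (d : Fin (q + 1))
    (hd : d ≠ 0) : ReflTransGen Step (0 :: l, () :: r) (d :: l, r) := by
  obtain ⟨n, hn⟩ := d
  obtain ⟨n, rfl⟩ := Nat.exists_eq_succ_of_ne_zero (fun h => hd (Fin.ext h) : n ≠ 0)
  induction n with
  | zero =>
    refine .single ?_
    have := val_add_one (0 : Fin (q + 1)) (Fin.ne_of_val_ne (by simp; omega))
    rw [zero_add] at this
    simp only [Step, succ, if_true, Prod.mk.injEq, true_and, List.cons.injEq, and_true]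
    exact Fin.ext (by simpa using this)
  | succ n ih =>
    have hl : (⟨n + 1, by omega⟩ : Fin (q + 1)) ≠ Fin.last q := Fin.ne_of_val_ne (by simp; omega)
    have h0 : (⟨n + 1, by omega⟩ : Fin (q + 1)) ≠ 0 := Fin.ne_of_val_ne (by simp)
    refine (ih (by omega) h0).tail ?_
    simp only [Step, succ]
    rw [if_neg h0, if_neg hl]
    simp only [Prod.mk.injEq, true_and, List.cons.injEq, and_true]
    exact Fin.ext (by rw [val_add_one _ hl])

/-- If the budget is empty, the carry passes over the leading zero at once. Otherwise the leading
digit first counts up to `q`, and the next carry resets it and returns its unit, so that the tail is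
changed with the full budget. -/
theorem reach_cons_of_step (hq : 0 < q) {s s' : List (Fin (q + 1)) × List Unit} (h : Step s s') :
    ReflTransGen Step (0 :: s.1, s.2) (0 :: s'.1, s'.2) := by
  obtain ⟨l, r⟩ := s
  cases r with
  | nil =>
    refine .single ?_
    simp only [Step, succ, if_true] at h ⊢
    rw [h]
  | cons u r =>
    have hl : Fin.last q ≠ 0 := Fin.ne_of_val_ne (by simp; omega)
    refine (reach_digit hq l r (Fin.last q) hl).tail ?_
    simp only [Step, succ, hl, if_false, if_true] at h ⊢
    rw [h]

theorem reach_of_weight_le (hq : 0 < q) (b : ℕ) (l : List (Fin (q + 1))) (hl : weight l ≤ b) :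
    ReflTransGen Step (List.replicate l.length 0, List.replicate b ())
      (l, List.replicate (b - weight l) ()) := by
  induction l with
  | nil => exact .refl
  | cons d l ih =>
    rw [weight_cons] at hl ⊢
    have h₁ : ReflTransGen Step (List.replicate (l.length + 1) 0, List.replicate b ())
        (0 :: l, List.replicate (b - weight l) ()) :=
      ReflTransGen.lift' (fun s : List (Fin (q + 1)) × List Unit => (0 :: s.1, s.2))
        (fun s s' h => reach_cons_of_step hq h) _ _ (ih (by omega))
    refine h₁.trans ?_
    split_ifs at hl ⊢ with hd
    · rw [hd, add_zero]
    · have h₂ := reach_digit hq l (List.replicate (b - (weight l + 1)) ()) d hd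
      rwa [← List.replicate_succ, show b - (weight l + 1) + 1 = b - weight l by omega] at h₂

/-- Finitely many lists, among them all lists of length `n` with at most `b` nonzero digits. -/
def sparse (q n : ℕ) : ℕ → Finset (List (Fin (q + 1)))
  | 0 => {List.replicate n 0}
  | b + 1 => Finset.image (fun x : Option (Fin n × Fin (q + 1)) × List (Fin (q + 1)) =>
      x.1.elim x.2 fun y => x.2.set y.1 y.2) (Finset.univ ×ˢ sparse q n b)

theorem card_sparse_le (q n b : ℕ) : (sparse q n b).card ≤ (n * (q + 1) + 1) ^ b := by
  induction b with
  | zero => simp [sparse]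
  | succ b ih =>
    refine Finset.card_image_le.trans ?_
    rw [Finset.card_product, pow_succ, mul_comm]
    exact Nat.mul_le_mul ih (by simp)

theorem sparse_subset_succ (q n b : ℕ) : sparse q n b ⊆ sparse q n (b + 1) := fun l hl =>
  Finset.mem_image.2 ⟨(none, l), by simpa using hl, rfl⟩

/-- A list of weight `b + 1` arises from one of weight `b` by overwriting a single entry, namely a
nonzero one that was reset. -/
theorem mem_sparse (l : List (Fin (q + 1))) {b : ℕ} (h : weight l ≤ b) :
    l ∈ sparse q l.length b := by
  induction b generalizing l with
  | zero =>
    have : l = List.replicate l.length 0 := by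
      rw [List.eq_replicate_iff]
      refine ⟨rfl, fun d hd => ?_⟩
      by_contra hne
      have : 0 < weight l := List.countP_pos_iff.2 ⟨d, hd, by simpa using hne⟩
      omega
    exact Finset.mem_singleton.2 this
  | succ b ih =>
    by_cases h' : weight l ≤ b
    · exact sparse_subset_succ _ _ _ (ih l h')
    · obtain ⟨d, hd, hne⟩ := List.countP_pos_iff.1 (show 0 < weight l by omega)
      obtain ⟨i, hi, rfl⟩ := List.mem_iff_getElem.1 hd
      have hw : ∀ (l : List (Fin (q + 1))) (i : ℕ) (hi : i < l.length), l[i] ≠ 0 →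
          weight (l.set i 0) + 1 = weight l := by
        intro l
        induction l with
        | nil => intro i hi; simp at hi
        | cons d l ih =>
          intro i hi hne
          cases i with
          | zero => simp at hne; simp [hne]
          | succ i =>
            have := ih i (by simpa using hi) (by simpa using hne)
            simp only [List.set_cons_succ, weight_cons]; omega
      have hmem := ih (l.set i 0) (by have := hw l i hi (by simpa using hne); omega)
      rw [List.length_set] at hmem
      refine Finset.mem_image.2 ⟨(some (⟨i, hi⟩, l[i]), l.set i 0), by simpa using hmem, ?_⟩
      simp

end Sparse

/-! ### Searching through the sparse candidates -/

namespace SProg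

open Sparse Relation

variable {h : ℕ} {p : Fin h → ℕ} {q : ℕ} {α β : Type} {s s₁ s' : Store p q} {t t' : ℕ}

/-- Increase the first digit for which this is possible, and erase the previous ones. -/
def carry : SProg p q Bool :=
  while_ (pop .X fun o => match o with
    | none => done false
    | some d =>
      if d = 0 then pop .R fun o => match o with
        | none => push .Y 0 next
        | some _ => push .Y 1 (done true)
      else if d = Fin.last q then push .R () (push .Y 0 next)
      else push .Y (d + 1) (done true))

/-- The digits that were passed lie on `Y` in reversed order, so where the result is split into `l₁`
and `l₂` depends on where the carry stops. -/
theorem exec_carry : ∃ l₁ l₂, l₁.reverse ++ l₂ = (succ s.X s.R).2.1 ∧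
    Exec carry s (5 * s.X.length + 5) (succ s.X s.R).1
      { s with X := l₂, Y := l₁ ++ s.Y, R := (succ s.X s.R).2.2 } := by
  generalize hX : s.X = X
  induction X generalizing s with
  | nil =>
    refine ⟨[], [], rfl, exec_loop_exit (Exec.mono (exec_pop (t := 1) ?_) (by simp))⟩
    simp only [Store.get, Store.set, hX, List.head?_nil, List.tail_nil]
    exact exec_ret _
  | cons d X ih =>
    simp only [succ]
    split_ifs with h₁ h₂
    · subst h₁
      rcases hR : s.R with _ | ⟨u, R⟩
      · obtain ⟨l₁, l₂, hl, hk⟩ := ih (s := { s with X := X, Y := 0 :: s.Y }) rfl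
        simp only [hR] at hk hl
        refine ⟨l₁ ++ [0], l₂, by simp [hl], Exec.of_eq (exec_loop_continue (t := 5)
          (exec_pop (t := 4) ?_) hk) (by simp; omega) (by simp)⟩
        simp only [Store.get, Store.set, hX, List.head?_cons, List.tail_cons, if_true]
        refine Exec.mono (exec_pop (t := 2) ?_) (by omega)
        simp only [Store.get, Store.set, hR, List.head?_nil, List.tail_nil]
        exact Exec.of_eq (exec_push (exec_ret _)) (by omega) (by simp [Store.set, Store.get])
      · refine ⟨[1], X, by simp, exec_loop_exit (Exec.mono (exec_pop (t := 3) ?_) (by simp))⟩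
        simp only [Store.get, Store.set, hX, List.head?_cons, List.tail_cons, if_true]
        refine Exec.mono (exec_pop (t := 2) ?_) (by omega)
        simp only [Store.get, Store.set, hR, List.head?_cons, List.tail_cons]
        exact Exec.of_eq (exec_push (exec_ret _)) (by omega) (by simp [Store.set, Store.get])
    · obtain ⟨l₁, l₂, hl, hk⟩ := ih (s := { s with X := X, R := () :: s.R, Y := 0 :: s.Y }) rfl
      simp only at hk hl
      refine ⟨l₁ ++ [0], l₂, by simp [hl], Exec.of_eq (exec_loop_continue (t := 5)
        (exec_pop (t := 4) ?_) hk) (by simp; omega) (by simp)⟩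
      simp only [Store.get, Store.set, hX, List.head?_cons, List.tail_cons, if_neg h₁, if_pos h₂]
      exact Exec.of_eq (exec_push (exec_push (exec_ret _))) (by omega)
        (by simp [Store.set, Store.get])
    · refine ⟨[d + 1], X, by simp, exec_loop_exit (Exec.mono (exec_pop (t := 3) ?_)
        (by simp))⟩
      simp only [Store.get, Store.set, hX, List.head?_cons, List.tail_cons, if_neg h₁, if_neg h₂]
      exact Exec.of_eq (exec_push (exec_ret _)) (by omega) (by simp [Store.set, Store.get])

/-- Replace the candidate valuation by its successor, if there is one. -/
def advance : SProg p q Bool :=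
  bind carry fun b => bind (move .Y .X id) fun _ => ret b

theorem exec_advance (hY : s.Y = []) :
    Exec advance s (8 * s.X.length + 10) (succ s.X s.R).1
      { s with X := (succ s.X s.R).2.1, R := (succ s.X s.R).2.2 } := by
  obtain ⟨l₁, l₂, hl, hk⟩ := exec_carry (s := s)
  refine Exec.of_eq (exec_bind hk (exec_bind (exec_move (by decide) _) (exec_ret _))) ?_ ?_
  · have := congrArg List.length hl
    simp only [List.length_append, List.length_reverse, length_succ] at this
    simp [Store.get, hY]; omega
  · simp [Store.get, Store.set, hY, ← hl]

/-- Search for a candidate valuation for which the program `P` returns `b`. -/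
def search (P : SProg p q Bool) (b : Bool) : SProg p q Bool :=
  while_ (bind P fun b' => if b' = b then done true else
    bind advance fun c => if c then next else done false)

open Classical in
-- Induction on the number `k` of sparse lists that represent larger numbers than the current
-- candidate. All candidates lie in one set `sparse q n _` by `weight_succ`, so at most `k + 1` of
-- them are tested.
theorem exec_search (hq : 0 < q) (P : SProg p q Bool) (b : Bool) (f : List (Fin (q + 1)) → Bool)
    (n k T : ℕ) (hn : s.X.length = n) (hY : s.Y = [])
    (hP : ∀ s' : Store p q, s'.X.length = n → (∃ X R, s' = { s with X := X, R := R }) →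
      Exec P s' T (f s'.X) s')
    (hk : ((sparse q n (weight s.X + s.R.length)).filter
      fun l => number s.X < number l).card ≤ k) :
    ∃ X R, X.length = n ∧ R.length ≤ weight s.X + s.R.length ∧
      Exec (search P b) s ((k + 1) * (T + 8 * n + 20))
        (decide (∃ s', ReflTransGen Step (s.X, s.R) s' ∧ f s'.1 = b)) { s with X := X, R := R } := by
  induction k using Nat.strong_induction_on generalizing s with
  | _ k ih =>
  have hT : T + 8 * n + 20 ≤ (k + 1) * (T + 8 * n + 20) := Nat.le_mul_of_pos_left _ (by omega)
  have hPs := hP s hn ⟨_, _, rfl⟩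
  by_cases hf : f s.X = b
  · refine ⟨s.X, s.R, hn, by omega, ?_⟩
    rw [decide_eq_true ⟨(s.X, s.R), .refl, hf⟩]
    refine exec_loop_exit (Exec.mono (exec_bind hPs (t' := 1) ?_) (by omega))
    rw [if_pos hf]
    exact exec_ret _
  · have ha := exec_advance hY
    rw [hn] at ha
    rcases hs : (succ s.X s.R).1 with _ | _
    · rw [hs] at ha
      rw [decide_eq_false]
      · refine ⟨_, (succ s.X s.R).2.2, (length_succ s.X s.R).trans hn, ?_, exec_loop_exit (Exec.mono (exec_bind hPs
          (t' := 8 * n + 10 + 1) ?_) (by omega))⟩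
        · have := weight_succ hq s.X s.R
          omega
        · rw [if_neg hf]
          exact exec_bind ha (exec_ret _)
      · rintro ⟨s', h₁, h₂⟩
        rcases h₁.cases_head with rfl | ⟨s₂, h₃, -⟩
        · exact hf h₂
        · rw [Step, Prod.ext_iff] at h₃
          simp [hs] at h₃
    · rw [hs] at ha
      have hw := weight_succ hq s.X s.R
      have hlen := (length_succ s.X s.R).trans hn
      have hlt := number_lt_number_succ hq _ _ hs
      set s₁ : Store p q := { s with X := (succ s.X s.R).2.1, R := (succ s.X s.R).2.2 } with hs₁
      -- The successor itself belongs to the old set and no longer to the new one.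
      have hcard : ((sparse q n (weight s₁.X + s₁.R.length)).filter
          fun l => number s₁.X < number l).card < ((sparse q n (weight s.X + s.R.length)).filter
          fun l => number s.X < number l).card := by
        rw [show weight s₁.X + s₁.R.length = _ from hw]
        refine Finset.card_lt_card ⟨fun l hl => ?_, fun hsub => ?_⟩
        · rw [Finset.mem_filter] at hl ⊢
          exact ⟨hl.1, hlt.trans hl.2⟩
        · have hmem := mem_sparse s₁.X (b := weight s.X + s.R.length) (by
            rw [← hw]; exact Nat.le_add_right _ _)
          rw [show s₁.X.length = n from hlen] at hmem
          have := hsub (Finset.mem_filter.2 ⟨hmem, hlt⟩)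
          simp at this
      obtain ⟨X, R, h₁, h₂, h₃⟩ := ih (k - 1) (by omega) (s := s₁) hlen hY (fun s' h₁ h₂ => hP s' h₁ h₂)
        (by omega)
      refine ⟨X, R, h₁, h₂.trans hw.le, ?_⟩
      have hiff : (∃ s', ReflTransGen Step (s₁.X, s₁.R) s' ∧ f s'.1 = b) ↔
          ∃ s', ReflTransGen Step (s.X, s.R) s' ∧ f s'.1 = b := by
        have hstep : Step (s.X, s.R) (s₁.X, s₁.R) := Prod.ext hs rfl
        constructor
        · rintro ⟨s', h₁, h₂⟩
          exact ⟨s', .head hstep h₁, h₂⟩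
        · rintro ⟨s', h₁, h₂⟩
          rcases h₁.cases_head with rfl | ⟨s₂, h₃, h₄⟩
          · exact absurd h₂ hf
          · have : s₂ = (s₁.X, s₁.R) := (congrArg Prod.snd h₃).symm.trans rfl
            exact ⟨s', this ▸ h₄, h₂⟩
      rw [hiff] at h₃
      refine Exec.mono (exec_loop_continue (t := T + 8 * n + 20) (s₁ := s₁) (a' := ())
        (Exec.mono (exec_bind hPs (t' := 8 * n + 10 + 1) ?_) (by omega)) h₃) ?_
      · rw [if_neg hf]
        exact exec_bind ha (exec_ret _)
      · rw [show k - 1 + 1 = k by omega]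
        linarith [Nat.succ_mul k (T + 8 * n + 20)]

end SProg

/-! ### Computing the budget and assembling the search -/

namespace SProg

open Sparse

variable {h : ℕ} {p : Fin h → ℕ} {q : ℕ} {α β : Type} {s s₁ s' : Store p q} {t t' : ℕ}

/-- Whether a symbol stands for an input gate. -/
def isInputSym : DSym p → Bool
  | .input => true
  | _ => false

/-- Read the input, count its length, and write a zero for each input gate. -/
def scan : SProg p q Unit :=
  while_ (pop .I fun o => match o with
    | none => done ()
    | some x => push .J x (push .M () (if isInputSym x then push .X 0 next else next)))

theorem exec_scan : Exec scan s (5 * s.I.length + 2) () { s with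
      I := []
      J := s.I.reverse ++ s.J
      M := List.replicate s.I.length () ++ s.M
      X := List.replicate (s.I.countP isInputSym) 0 ++ s.X } := by
  generalize hI : s.I = I
  induction I generalizing s with
  | nil =>
    refine exec_loop_exit (exec_pop (t := 1) ?_)
    simp only [Store.get, Store.set, hI, List.head?_nil, List.tail_nil]
    exact exec_ret _
  | cons x I ih =>
    refine Exec.of_eq (exec_loop_continue (t := 5) (exec_pop (t := 4) ?_)
      (ih (s := { s with
        I := I, J := x :: s.J, M := () :: s.M,
        X := if isInputSym x then 0 :: s.X else s.X }) rfl)) (by simp; omega) ?_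
    · simp only [Store.get, Store.set, hI, List.head?_cons, List.tail_cons]
      refine exec_push (exec_push ?_)
      split_ifs
      · exact exec_push (exec_ret _)
      · exact (exec_ret _).mono (by omega)
    · by_cases hx : isInputSym x <;> simp [hx, List.replicate_succ']

/-- Halve the counter `M`, from which a mark was already taken. -/
def halve : SProg p q Unit :=
  while_ (pop .M fun o => match o with
    | none => done ()
    | some _ => push .N () (pop .M fun o => match o with
      | none => done ()
      | some _ => next))

theorem exec_halve (m : ℕ) (hM : s.M = List.replicate m ()) :
    Exec halve s (4 * m + 4) () { s with
      M := []
      N := List.replicate ((m + 1) / 2) () ++ s.N } := by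
  induction m using Nat.strong_induction_on generalizing s with
  | _ m ih =>
  match m, ih, hM with
  | 0, _, hM =>
    refine exec_loop_exit (Exec.mono (exec_pop (t := 1) ?_) (by omega))
    simp only [Store.get, Store.set, hM, List.replicate_zero, List.head?_nil, List.tail_nil]
    exact exec_ret _
  | 1, _, hM =>
    refine exec_loop_exit (Exec.mono (exec_pop (t := 3) ?_) (by omega))
    simp only [Store.get, Store.set, hM, List.replicate_one, List.head?_cons, List.tail_cons]
    exact exec_push (exec_pop (exec_ret _))
  | m + 2, ih, hM =>
    refine Exec.of_eq (exec_loop_continue (t := 4) (exec_pop (t := 3) ?_)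
      (ih m (by omega) (s := { s with M := List.replicate m (), N := () :: s.N }) rfl))
      (by omega) ?_
    · simp only [Store.get, Store.set, hM, List.replicate_succ, List.head?_cons, List.tail_cons]
      exact exec_push (exec_pop (exec_ret _))
    · rw [show (m + 2 + 1) / 2 = (m + 1) / 2 + 1 by omega]
      simp [List.replicate_succ']

/-- Put the number of binary digits of the counter `M` on the stack `L`. -/
def logarithm : SProg p q Unit :=
  while_ (pop .M fun o => match o with
    | none => done ()
    | some _ => push .L () (bind halve fun _ => bind (move .N .M id) fun _ => next))

/-- Each halving removes one binary digit, and the costs of the halvings form a geometric series, so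
the total time is linear. -/
theorem exec_logarithm (m : ℕ) (hM : s.M = List.replicate m ()) (hN : s.N = []) :
    Exec logarithm s (20 * m + 2) () { s with
      M := []
      L := List.replicate m.size () ++ s.L } := by
  induction m using Nat.strong_induction_on generalizing s with
  | _ m ih =>
  rcases m with _ | m
  · refine exec_loop_exit (exec_pop (t := 1) ?_)
    simp only [Store.get, Store.set, hM, List.replicate_zero, List.head?_nil, List.tail_nil]
    exact exec_ret _
  · refine Exec.of_eq (exec_loop_continue (t := 4 * m + 3 * ((m + 1) / 2) + 9)
      (exec_pop (t := 4 * m + 3 * ((m + 1) / 2) + 8) ?_)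
      (ih ((m + 1) / 2) (by omega) (s := { s with
        M := List.replicate ((m + 1) / 2) (), L := () :: s.L }) rfl hN)) (by omega) ?_
    · simp only [Store.get, Store.set, hM, List.replicate_succ, List.head?_cons, List.tail_cons]
      refine exec_push ?_
      refine Exec.of_eq (exec_bind (exec_halve m rfl) (exec_bind (exec_move (by decide) _)
        (exec_ret _))) ?_ ?_
      · simp [Store.get, Store.set, hN]; omega
      · simp [Store.get, Store.set, hN]
    · have : (m + 1).size = ((m + 1) / 2).size + 1 := by
        rw [← Nat.div2_val]
        rcases Nat.even_or_odd' (m + 1) with ⟨k, hk | hk⟩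
        · rw [hk, Nat.div2_val, Nat.mul_div_cancel_left _ two_pos, ← Nat.bit_false_apply,
            Nat.size_bit (by simp; omega)]
        · rw [hk, Nat.div2_val, ← Nat.bit_true_apply, Nat.size_bit (by simp), Nat.bit_true_apply]
          congr 2
          omega
      rw [this]
      simp [List.replicate_succ']

/-- Add the number on the stack `L` to the counter `M`. -/
def addLog : SProg p q Unit :=
  bind (while_ (pop .L fun o => match o with
    | none => done ()
    | some _ => push .N () (push .M () next))) fun _ => move .N .L id

theorem exec_addLog (l : ℕ) (hL : s.L = List.replicate l ()) (hN : s.N = []) :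
    Exec addLog s (7 * l + 4) () { s with M := List.replicate l () ++ s.M } := by
  have key : ∀ (s : Store p q) (l : ℕ), s.L = List.replicate l () →
      Exec (while_ (pop .L fun o => match o with
        | none => done ()
        | some _ => push .N () (push .M () next))) s (4 * l + 2) () { s with
          L := []
          N := List.replicate l () ++ s.N
          M := List.replicate l () ++ s.M } := by
    intro s l hL
    induction l generalizing s with
    | zero =>
      refine exec_loop_exit (exec_pop (t := 1) ?_)
      simp only [Store.get, Store.set, hL, List.replicate_zero, List.head?_nil, List.tail_nil]
      exact exec_ret _
    | succ l ih =>
      refine Exec.of_eq (exec_loop_continue (t := 4) (exec_pop (t := 3) ?_)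
        (ih { s with L := List.replicate l (), M := () :: s.M, N := () :: s.N } rfl)) (by omega) ?_
      · simp only [Store.get, Store.set, hL, List.replicate_succ, List.head?_cons, List.tail_cons]
        exact exec_push (exec_push (exec_ret _))
      · simp [List.replicate_succ']
  refine Exec.of_eq (exec_bind (key s l hL) (exec_move (by decide) _)) ?_ ?_
  · simp [Store.get, hN]; omega
  · simp [Store.get, Store.set, hN, hL]

/-- Multiply the budget by the number on the stack `L`. -/
def mulLog : SProg p q Unit :=
  bind (while_ (pop .R fun o => match o with
    | none => done ()
    | some _ => bind addLog fun _ => next)) fun _ => move .M .R id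

theorem exec_mulLog (l r : ℕ) (hL : s.L = List.replicate l ()) (hR : s.R = List.replicate r ())
    (hM : s.M = []) (hN : s.N = []) :
    Exec mulLog s (10 * (r + 1) * (l + 1)) () { s with R := List.replicate (r * l) () } := by
  have key : ∀ (s : Store p q) (r : ℕ), s.L = List.replicate l () → s.R = List.replicate r () →
      s.N = [] → Exec (while_ (pop .R fun o => match o with
        | none => done ()
        | some _ => bind addLog fun _ => next)) s (r * (7 * l + 6) + 2) () { s with
          R := []
          M := List.replicate (r * l) () ++ s.M } := by
    intro s r hL hR hN
    induction r generalizing s with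
    | zero =>
      refine exec_loop_exit (Exec.of_eq (exec_pop (t := 1) (s' := { s with R := [] }) ?_)
        (by omega) (by simp))
      simp only [Store.get, Store.set, hR, List.replicate_zero, List.head?_nil, List.tail_nil]
      exact exec_ret _
    | succ r ih =>
      refine Exec.of_eq (exec_loop_continue (t := 7 * l + 6) (exec_pop (t := 7 * l + 5) ?_)
        (ih { s with R := List.replicate r (), M := List.replicate l () ++ s.M } hL rfl hN))
        (by rw [Nat.succ_mul r]; omega) ?_
      · simp only [Store.get, Store.set, hR, List.replicate_succ, List.head?_cons, List.tail_cons]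
        exact Exec.of_eq (exec_bind (exec_addLog l hL hN) (exec_ret _)) le_rfl rfl
      · simp [Nat.succ_mul, ← List.append_assoc]
  refine Exec.of_eq (exec_bind (key s r hL hR hN) (exec_move (by decide) _)) ?_ ?_
  · simp [Store.get, hM]; nlinarith
  · simp [Store.get, Store.set, hM]

/-- Add `a` to the budget. -/
def addBudget : ℕ → SProg p q Unit
  | 0 => ret ()
  | a + 1 => push .R () (addBudget a)

theorem exec_addBudget (a : ℕ) :
    Exec (addBudget a) s (a + 1) () { s with R := List.replicate a () ++ s.R } := by
  induction a generalizing s with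
  | zero => exact exec_ret _
  | succ a ih =>
    refine Exec.of_eq (exec_push ih) (by omega) ?_
    simp [Store.get, Store.set, List.replicate_succ']

/-- Multiply the budget by the `k`-th power of the number on the stack `L`. -/
def mulLogPow : ℕ → SProg p q Unit
  | 0 => ret ()
  | k + 1 => bind (mulLogPow k) fun _ => mulLog

theorem exec_mulLogPow (l a k : ℕ) (hl : 1 ≤ l) (hL : s.L = List.replicate l ())
    (hR : s.R = List.replicate a ()) (hM : s.M = []) (hN : s.N = []) :
    Exec (mulLogPow k) s (10 * k * (a * l ^ k + 1) * (l + 1) + 1) ()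
      { s with R := List.replicate (a * l ^ k) () } := by
  induction k with
  | zero =>
    refine Exec.of_eq (exec_ret _) (by omega) ?_
    simp [← hR]
  | succ k ih =>
    refine Exec.of_eq (exec_bind ih (exec_mulLog l (a * l ^ k) hL rfl hM hN)) ?_ ?_
    · have h₁ : a * l ^ k ≤ a * l ^ (k + 1) :=
        Nat.mul_le_mul_left _ (Nat.pow_le_pow_right hl (by omega))
      have h₂ : 10 * k * (a * l ^ k + 1) * (l + 1) ≤ 10 * k * (a * l ^ (k + 1) + 1) * (l + 1) := by
        gcongr
      have h₃ : 10 * (a * l ^ k + 1) * (l + 1) ≤ 10 * (a * l ^ (k + 1) + 1) * (l + 1) := by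
        gcongr
      nlinarith
    · simp [pow_succ, mul_assoc]

/-- Search for a valuation with a bounded number of nonzero inputs for which the answer to the
question whether the values of the two output gates are equal is `b`, and return `found` if there is
one. -/
def decideSparse (dec : Fin (q + 1) → DAlg p) [Finite (DAlg p)] [DecidableEq (DAlg p)] (a k : ℕ)
    (b found : Bool) : SProg p q Unit :=
  bind scan fun _ => bind (move .J .I id) fun _ => bind logarithm fun _ => bind (addBudget a) fun _ =>
  bind (mulLogPow k) fun _ => bind (search (test dec) b) fun c =>
  bind (clear .I) fun _ => bind (clear .X) fun _ => bind (clear .R) fun _ => bind (clear .L) fun _ =>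
  push .O (if c then found else !found) (ret ())

/-- A bound for the time of `decideSparse`. -/
def timeBound (q a k n : ℕ) : ℕ :=
  (300 * (k + 1) * (n + a * n.size ^ k + 10) ^ 2) *
    ((n * (q + 1) + 1) ^ (a * n.size ^ k) + 1)

theorem size_le_length (Γ : DCircuit p) : Γ.size ≤ (DSym.encodeCircuit Γ).length := by
  have : ∀ gs : List (DGate p), gs.length ≤ (gs.flatMap DSym.encodeGate).length := by
    intro gs
    induction gs with
    | nil => simp
    | cons g gs ih =>
      have := length_encodeGate_pos g
      simp only [List.flatMap_cons, List.length_append, List.length_cons]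
      omega
  rw [DSym.encodeCircuit, List.length_append]
  exact (this _).trans (Nat.le_add_right _ _)

open Classical Relation in
theorem exec_decideSparse (hq : 0 < q) (dec : Fin (q + 1) → DAlg p) [Finite (DAlg p)]
    [DecidableEq (DAlg p)] (a k : ℕ) (b found : Bool) (Γ : DCircuit p) (N n : ℕ)
    (hN : (DSym.encodeCircuit Γ).length = N) (hn : (DSym.encodeCircuit Γ).countP isInputSym = n) :
    Exec (decideSparse dec a k b found) { I := DSym.encodeCircuit Γ } (timeBound q a k N) ()
      { O := [if ∃ s', ReflTransGen Step (List.replicate n 0, List.replicate (a * N.size ^ k) ()) s' ∧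
          decide ((DGate.evalList dec Γ.gates [] s'.1).getD Γ.out₁ 0 =
            (DGate.evalList dec Γ.gates [] s'.1).getD Γ.out₂ 0) = b then found else !found] } := by
  have hNpos : 0 < N := by
    rw [← hN, DSym.encodeCircuit]; simp
  have hsize : 1 ≤ N.size := Nat.size_pos.2 hNpos
  have hsizeN : N.size ≤ N := Nat.size_le.2 Nat.lt_two_pow_self
  have hnN : n ≤ N := hn ▸ hN ▸ List.countP_le_length
  have haB : a ≤ a * N.size ^ k := Nat.le_mul_of_pos_right _ (pow_pos hsize k)
  generalize hB : a * N.size ^ k = B at haB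
  let s₁ : Store p q := {
    I := DSym.encodeCircuit Γ
    X := List.replicate n 0
    R := List.replicate B ()
    L := List.replicate N.size () }
  have hweight : weight s₁.X = 0 := by
    rw [weight, List.countP_eq_zero]
    intro d hd
    simp [List.eq_of_mem_replicate hd]
  have hR : s₁.R.length = B := List.length_replicate
  -- The encoding and the list of digits both have length at most `N`, hence the parameter `2 * N`
  -- of the test. The search starts with weight `0` and budget `B`, so `sparse q n B` contains all
  -- candidates.
  obtain ⟨X, R, hX, hR', hs⟩ := exec_search (s := s₁) hq (test dec) b
    (fun l => decide ((DGate.evalList dec Γ.gates [] l).getD Γ.out₁ 0 =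
      (DGate.evalList dec Γ.gates [] l).getD Γ.out₂ 0)) n ((n * (q + 1) + 1) ^ B)
    (30 * (2 * N + 3) ^ 2) List.length_replicate rfl
    (by
      rintro s' h₁ ⟨X, R, rfl⟩
      exact exec_test dec Γ (2 * N) (by
        simp only [s₁, hN] at h₁ ⊢; omega) ((size_le_length Γ).trans (by omega)) rfl rfl rfl rfl rfl)
    ((Finset.card_filter_le _ _).trans (by
      rw [hweight, hR, zero_add]; exact card_sparse_le q n B))
  rw [hweight, hR, zero_add] at hR'
  have hscan : Exec scan { I := DSym.encodeCircuit Γ } (5 * N + 2) () ({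
      J := (DSym.encodeCircuit Γ).reverse
      M := List.replicate N ()
      X := List.replicate n 0 } : Store p q) :=
    Exec.of_eq exec_scan (by simp [hN]) (by simp [hN, hn])
  have hmove : Exec (move .J .I id) ({
      J := (DSym.encodeCircuit Γ).reverse
      M := List.replicate N ()
      X := List.replicate n 0 } : Store p q) (3 * N + 2) () {
      I := DSym.encodeCircuit Γ
      M := List.replicate N ()
      X := List.replicate n 0 } :=
    Exec.of_eq (exec_move (by decide) _) (by simp [Store.get, hN]) (by simp [Store.get, Store.set])
  have hlog : Exec logarithm ({
      I := DSym.encodeCircuit Γ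
      M := List.replicate N ()
      X := List.replicate n 0 } : Store p q) (20 * N + 2) () {
      I := DSym.encodeCircuit Γ
      L := List.replicate N.size ()
      X := List.replicate n 0 } :=
    Exec.of_eq (exec_logarithm N rfl rfl) le_rfl (by simp)
  have hadd : Exec (addBudget a) ({
      I := DSym.encodeCircuit Γ
      L := List.replicate N.size ()
      X := List.replicate n 0 } : Store p q) (a + 1) () {
      I := DSym.encodeCircuit Γ
      L := List.replicate N.size ()
      X := List.replicate n 0
      R := List.replicate a () } :=
    Exec.of_eq (exec_addBudget a) le_rfl (by simp)
  have hmul : Exec (mulLogPow k) ({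
      I := DSym.encodeCircuit Γ
      L := List.replicate N.size ()
      X := List.replicate n 0
      R := List.replicate a () } : Store p q) (10 * k * (B + 1) * (N.size + 1) + 1) () s₁ := by
    rw [← hB]
    refine Exec.of_eq (exec_mulLogPow N.size a k hsize rfl rfl rfl rfl) le_rfl ?_
    simp [s₁, hB]
  refine Exec.of_eq (exec_bind hscan (exec_bind hmove (exec_bind hlog (exec_bind hadd (exec_bind hmul
    (exec_bind hs (exec_bind exec_clear (exec_bind exec_clear (exec_bind exec_clear
    (exec_bind exec_clear (exec_push (exec_ret _))))))))))) ) ?_ ?_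
  · simp only [Store.get, Store.set, timeBound, s₁, hN, hX, List.length_replicate, hB]
    have h₁ : (n * (q + 1) + 1) ^ B ≤ (N * (q + 1) + 1) ^ B := by gcongr
    generalize (n * (q + 1) + 1) ^ B = P at h₁
    generalize (N * (q + 1) + 1) ^ B = Q at h₁ ⊢
    set Z := N + B + 10 with hZ
    have h₂ : 30 * (2 * N + 3) ^ 2 + 8 * n + 20 ≤ 150 * (k + 1) * Z ^ 2 := by
      have : 30 * (2 * N + 3) ^ 2 + 8 * n + 20 ≤ 150 * Z ^ 2 := by
        rw [hZ]; nlinarith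
      nlinarith [Nat.zero_le (k * Z ^ 2)]
    have h₃ : (P + 1) * (30 * (2 * N + 3) ^ 2 + 8 * n + 20) ≤ (Q + 1) * (150 * (k + 1) * Z ^ 2) :=
      Nat.mul_le_mul (by omega) h₂
    have h₄ : 10 * k * (B + 1) * (N.size + 1) ≤ 10 * k * Z ^ 2 := by
      rw [pow_two, mul_assoc]
      refine Nat.mul_le_mul_left _ (Nat.mul_le_mul (by omega) (by omega))
    have h₅ : 10 * Z ≤ Z ^ 2 := by
      rw [pow_two]; exact Nat.mul_le_mul_right _ (by omega)
    have h₆ : 150 * (k + 1) * Z ^ 2 ≤ (Q + 1) * (150 * (k + 1) * Z ^ 2) :=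
      Nat.le_mul_of_pos_left _ (by omega)
    have h₇ : 150 * (k + 1) * Z ^ 2 = 150 * (k * Z ^ 2) + 150 * Z ^ 2 := by ring
    have h₈ : 300 * (k + 1) * Z ^ 2 * (Q + 1) = 2 * ((Q + 1) * (150 * (k + 1) * Z ^ 2)) := by ring
    rw [h₈]
    have h₉ : 10 * k * Z ^ 2 = 10 * (k * Z ^ 2) := by ring
    omega
  · simp only [Store.get, Store.set, s₁, decide_eq_true_eq]

end SProg

/-! ### Valuations as lists of digits, and correctness of the machine -/

section valuations

variable {h : ℕ} {p : Fin h → ℕ} {q : ℕ}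

/-- The values of the gates depend on the listed values of the input gates only. -/
theorem DGate.evalList_eq_foldl (dec : Fin (q + 1) → DAlg p) (x : ℕ → DAlg p)
    (gs : List (DGate p)) (vals : List (DAlg p)) (xs : List (Fin (q + 1)))
    (hx : ∀ (k : ℕ) (hk : k < gs.length), gs[k].isInput = true →
      x (vals.length + k) = dec ((xs.drop ((gs.take k).countP isInput)).headD 0)) :
    evalList dec gs vals xs =
      gs.foldl (fun vals g => vals ++ [g.value vals (x vals.length)]) vals := by
  induction gs generalizing vals xs with
  | nil => rfl
  | cons g gs ih =>
    have hg : g.value vals (dec (xs.headD 0)) = g.value vals (x vals.length) := by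
      have := hx 0 (by simp)
      cases g <;> simp_all [value, isInput]
    rw [evalList, List.foldl_cons, ← hg]
    refine ih _ _ fun k hk hi => ?_
    have := hx (k + 1) (by simpa using hk) (by simpa using hi)
    rw [List.length_append, List.length_singleton, add_assoc, add_comm 1 k, this, List.take_succ_cons,
      List.countP_cons]
    by_cases hgi : g.isInput = true
    · simp [hgi, List.drop_tail]
    · simp [hgi]

/-- The digits for the values of the input gates, where the gates are numbered from `k`. -/
def DGate.inputDigits (digit : DAlg p → Fin (q + 1)) (x : ℕ → DAlg p) :
    List (DGate p) → ℕ → List (Fin (q + 1))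
  | [], _ => []
  | g :: gs, k => if g.isInput then digit (x k) :: inputDigits digit x gs (k + 1)
    else inputDigits digit x gs (k + 1)

theorem DGate.length_inputDigits (digit : DAlg p → Fin (q + 1)) (x : ℕ → DAlg p)
    (gs : List (DGate p)) (k : ℕ) : (inputDigits digit x gs k).length = gs.countP isInput := by
  induction gs generalizing k with
  | nil => rfl
  | cons g gs ih =>
    rw [inputDigits, List.countP_cons]
    split_ifs <;> simp [ih]

theorem DGate.headD_drop_inputDigits (digit : DAlg p → Fin (q + 1)) (x : ℕ → DAlg p)
    (gs : List (DGate p)) (k j : ℕ) (hj : j < gs.length) (hi : gs[j].isInput = true) :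
    ((inputDigits digit x gs k).drop ((gs.take j).countP isInput)).headD 0 = digit (x (k + j)) := by
  induction gs generalizing k j with
  | nil => simp at hj
  | cons g gs ih =>
    cases j with
    | zero =>
      rw [List.getElem_cons_zero] at hi
      simp [inputDigits, hi]
    | succ j =>
      have := ih (k + 1) j (by simpa using hj) (by simpa using hi)
      rw [inputDigits, List.take_succ_cons, List.countP_cons, ← add_assoc, add_right_comm, ← this]
      by_cases hg : g.isInput = true <;> simp [hg]

theorem DGate.weight_inputDigits_le (digit : DAlg p → Fin (q + 1)) (hdigit : digit 0 = 0)
    (x : ℕ → DAlg p) (gs : List (DGate p)) (k : ℕ) :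
    Sparse.weight (inputDigits digit x gs k) ≤
      ((Finset.Ico k (k + gs.length)).filter (x · ≠ 0)).card := by
  induction gs generalizing k with
  | nil => simp [inputDigits]
  | cons g gs ih =>
    have hI : Finset.Ico k (k + (g :: gs).length) =
        insert k (Finset.Ico (k + 1) (k + 1 + gs.length)) := by
      ext i
      simp only [List.length_cons, Finset.mem_Ico, Finset.mem_insert]
      omega
    have hk : k ∉ (Finset.Ico (k + 1) (k + 1 + gs.length)).filter (x · ≠ 0) := by simp
    have := ih (k + 1)
    rw [hI, Finset.filter_insert, inputDigits]
    by_cases hxk : x k = 0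
    · simp only [hxk, hdigit]
      split_ifs <;> simp_all
    · rw [if_pos hxk, Finset.card_insert_of_notMem hk]
      split_ifs
      · rw [Sparse.weight_cons]
        split_ifs <;> omega
      · omega

namespace DCircuit

theorem countP_isInputSym_encodeCircuit (Γ : DCircuit p) :
    (DSym.encodeCircuit Γ).countP SProg.isInputSym = Γ.gates.countP DGate.isInput := by
  have hnum : ∀ a : ℕ, (DSym.encodeNum a : List (DSym p)).countP SProg.isInputSym = 0 := by
    intro a
    rw [List.countP_eq_zero]
    intro s hs
    simp only [DSym.encodeNum, List.mem_append, List.mem_singleton] at hs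
    rcases hs with hs | rfl
    · rw [List.eq_of_mem_replicate hs]
      simp [SProg.isInputSym]
    · simp [SProg.isInputSym]
  have hgate : ∀ g : DGate p, (DSym.encodeGate g).countP SProg.isInputSym =
      if g.isInput then 1 else 0 := by
    intro g
    cases g <;>
      simp [DSym.encodeGate, DGate.isInput, List.countP_cons, SProg.isInputSym, hnum]
  have hgates : ∀ gs : List (DGate p), (gs.flatMap DSym.encodeGate).countP SProg.isInputSym =
      gs.countP DGate.isInput := by
    intro gs
    induction gs with
    | nil => rfl
    | cons g gs ih =>
      rw [List.flatMap_cons, List.countP_append, ih, hgate, List.countP_cons, add_comm]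
  rw [DSym.encodeCircuit, List.countP_append, hgates, List.countP_cons, List.countP_append, hnum,
    hnum]
  simp [SProg.isInputSym]

/-- Arguments are smaller than `|Γ|`, so a unary number takes at most `|Γ|` symbols and a gate at
most `2 |Γ| + 1`. -/
theorem length_encodeCircuit_le (Γ : DCircuit p) :
    (DSym.encodeCircuit Γ).length ≤ 6 * Γ.size ^ 2 := by
  have hpos : 0 < Γ.size := lt_of_le_of_lt (Nat.zero_le _) Γ.out₁_lt
  have h₁ : (Γ.gates.flatMap DSym.encodeGate).length ≤ Γ.size * (2 * Γ.size + 1) := by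
    rw [List.length_flatMap]
    refine (List.sum_le_card_nsmul _ (2 * Γ.size + 1) fun n hn => ?_).trans ?_
    · obtain ⟨g, hg, rfl⟩ := List.mem_map.1 hn
      obtain ⟨k, hk, rfl⟩ := List.mem_iff_getElem.1 hg
      have hargs := Γ.args_lt k hk
      have hk' : k < Γ.size := hk
      revert hargs
      generalize Γ.gates[k] = g
      intro hargs
      cases g <;> simp [DSym.encodeGate, DSym.encodeNum, DGate.args] at hargs ⊢ <;> omega
    · rw [List.length_map, smul_eq_mul]
      rfl
  have h₂ := Γ.out₁_lt
  have h₃ := Γ.out₂_lt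
  simp only [DSym.encodeCircuit, DSym.encodeNum, List.length_append, List.length_cons,
    List.length_replicate, List.length_nil]
  change _ < Γ.size at h₂
  change _ < Γ.size at h₃
  nlinarith

open Relation Sparse in
/-- The candidate valuations of the search machine suffice if there are sparse ones. -/
theorem exists_reach_iff [DecidableEq (DAlg p)] (hq : 0 < q) (dec : Fin (q + 1) → DAlg p)
    (digit : DAlg p → Fin (q + 1)) (hdec : ∀ d, dec (digit d) = d) (hdigit : digit 0 = 0)
    (Γ : DCircuit p) (b : Bool) (B : ℕ)
    (hB : (∃ x, decide (Γ.value x Γ.out₁ = Γ.value x Γ.out₂) = b) →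
      ∃ x, decide (Γ.value x Γ.out₁ = Γ.value x Γ.out₂) = b ∧ (Γ.support x).card ≤ B) :
    (∃ s', ReflTransGen Step (List.replicate (Γ.gates.countP DGate.isInput) 0,
        List.replicate B ()) s' ∧
      decide ((DGate.evalList dec Γ.gates [] s'.1).getD Γ.out₁ 0 =
        (DGate.evalList dec Γ.gates [] s'.1).getD Γ.out₂ 0) = b) ↔
    ∃ x, decide (Γ.value x Γ.out₁ = Γ.value x Γ.out₂) = b := by
  constructor
  · rintro ⟨⟨xs, r⟩, -, hs⟩
    -- An input gate gets the digit indexed by the number of input gates before it; what is assigned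
    -- to other gates has no effect.
    refine ⟨fun k => dec ((xs.drop ((Γ.gates.take k).countP DGate.isInput)).headD 0), ?_⟩
    rw [DGate.evalList_eq_foldl dec _ Γ.gates [] xs (fun k _ _ => by
      rw [List.length_nil, zero_add])] at hs
    exact hs
  · intro hx
    obtain ⟨x, hx, hcard⟩ := hB hx
    have hw : weight (DGate.inputDigits digit x Γ.gates 0) ≤ B := by
      refine (DGate.weight_inputDigits_le digit hdigit x Γ.gates 0).trans (le_trans ?_ hcard)
      rw [zero_add, ← Finset.range_eq_Ico]
      rfl
    have hreach := reach_of_weight_le hq B _ hw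
    rw [DGate.length_inputDigits] at hreach
    refine ⟨_, hreach, ?_⟩
    rw [DGate.evalList_eq_foldl dec x]
    · exact hx
    · intro k hk hi
      rw [DGate.headD_drop_inputDigits digit x _ 0 k hk hi, hdec, List.length_nil]

end DCircuit

theorem DSym.finite [Finite (DAlg p)] : Finite (DSym p) := by
  let f : (DAlg p ⊕ Fin h ⊕ Fin (h - 1)) ⊕ Fin 6 → DSym p := fun s => match s with
    | .inl (.inl d) => .const d
    | .inl (.inr (.inl j)) => .e j
    | .inl (.inr (.inr j)) => .v j
    | .inr 0 => .input
    | .inr 1 => .add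
    | .inr 2 => .neg
    | .inr 3 => .tick
    | .inr 4 => .sep
    | .inr 5 => .out
  refine Finite.of_surjective f fun s => ?_
  cases s with
  | input => exact ⟨.inr 0, rfl⟩
  | const d => exact ⟨.inl (.inl d), rfl⟩
  | add => exact ⟨.inr 1, rfl⟩
  | neg => exact ⟨.inr 2, rfl⟩
  | e j => exact ⟨.inl (.inr (.inl j)), rfl⟩
  | v j => exact ⟨.inl (.inr (.inr j)), rfl⟩
  | tick => exact ⟨.inr 3, rfl⟩
  | sep => exact ⟨.inr 4, rfl⟩
  | out => exact ⟨.inr 5, rfl⟩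

theorem timeBound_mono (q a k : ℕ) : Monotone (SProg.timeBound q a k) := by
  intro n m hnm
  have h₁ : a * n.size ^ k ≤ a * m.size ^ k :=
    Nat.mul_le_mul_left _ (Nat.pow_le_pow_left (Nat.size_le_size hnm) _)
  have h₂ : (n * (q + 1) + 1) ^ (a * n.size ^ k) ≤ (m * (q + 1) + 1) ^ (a * m.size ^ k) :=
    (Nat.pow_le_pow_left (by gcongr) _).trans (Nat.pow_le_pow_right (by omega) h₁)
  unfold SProg.timeBound
  gcongr

open Classical in
/-- If sparse valuations suffice, then it is decided by a search whether there is a valuation for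
which the output gates have the same values, or different values. -/
theorem decidableInTime_of_sparse (hp : ∀ i, (p i).Prime) (a k : ℕ) (b found : Bool)
    (hsparse : ∀ Γ : DCircuit p, (∃ x, decide (Γ.value x Γ.out₁ = Γ.value x Γ.out₂) = b) →
      ∃ x, decide (Γ.value x Γ.out₁ = Γ.value x Γ.out₂) = b ∧
        (Γ.support x).card ≤ a * Γ.size.size ^ k)
    (Q : DCircuit p → Prop)
    (hQ : ∀ Γ, (if ∃ x, decide (Γ.value x Γ.out₁ = Γ.value x Γ.out₂) = b then found else !found) =
      true ↔ Q Γ) :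
    DecidableInTime (DSym.encodeCircuit (p := p)) DCircuit.size Q fun m =>
      SProg.timeBound (Nat.card (DAlg p)) a k (6 * m ^ 2) + 1 := by
  have hne : ∀ i, NeZero (p i) := fun i => ⟨(hp i).ne_zero⟩
  have hfin : Finite (DAlg p) := inferInstance
  have hfin' : Finite (DSym p) := DSym.finite
  have hq : 0 < Nat.card (DAlg p) := Nat.card_pos
  let E := Finite.equivFin (DAlg p)
  -- The element `0` has two codes, the digit `0` and the one from `E`. As `digit` chooses the
  -- former, the weight of a list of digits is at most the support of the valuation.
  let dec : Fin (Nat.card (DAlg p) + 1) → DAlg p := Fin.cases 0 E.symm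
  let digit : DAlg p → Fin (Nat.card (DAlg p) + 1) := fun d => if d = 0 then 0 else (E d).succ
  have hdec : ∀ d, dec (digit d) = d := by
    intro d
    by_cases hd : d = 0 <;> simp [dec, digit, hd]
  have hdigit : digit 0 = 0 := by simp [digit]
  let : ∀ s, Fintype (StkSym p (Nat.card (DAlg p)) s) := fun s => by
    cases s <;> exact Fintype.ofFinite _
  let M : TM2ComputableAux (DSym p) Bool :=
    { tm := machine Stk.I Stk.O (SProg.decideSparse dec a k b found)
      inputAlphabet := Equiv.refl _
      outputAlphabet := Equiv.refl _ }
  refine ⟨M, fun Γ => ⟨_, hQ Γ, ?_⟩⟩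
  have hexec := SProg.exec_decideSparse hq dec a k b found Γ _ _ rfl rfl
  have hle : Γ.size ≤ (DSym.encodeCircuit Γ).length := SProg.size_le_length Γ
  -- The machine measures the length of the word instead of `|Γ|`. Since it is at least `|Γ|`, the
  -- budget computed from it is large enough.
  have hiff := DCircuit.exists_reach_iff hq dec digit hdec hdigit Γ b
    (a * (DSym.encodeCircuit Γ).length.size ^ k) (fun hx => by
      obtain ⟨x, hx, hcard⟩ := hsparse Γ hx
      exact ⟨x, hx, hcard.trans (Nat.mul_le_mul_left _ (Nat.pow_le_pow_left
        (Nat.size_le_size hle) _))⟩)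
  rw [DCircuit.countP_isInputSym_encodeCircuit] at hexec
  rw [if_congr hiff rfl rfl] at hexec
  have hin : ∀ l : List (DSym p), ({ I := l } : Store p (Nat.card (DAlg p))).get =
      update (β := fun s => List (StkSym p (Nat.card (DAlg p)) s)) (fun _ => []) Stk.I l := by
    intro l
    funext s
    cases s <;> simp [Store.get, update]
  have hout : ∀ l : List Bool, ({ O := l } : Store p (Nat.card (DAlg p))).get =
      update (β := fun s => List (StkSym p (Nat.card (DAlg p)) s)) (fun _ => []) Stk.O l := by
    intro l
    funext s
    cases s <;> simp [Store.get, update]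
  have hruns := hexec.mono (timeBound_mono _ a k Γ.length_encodeCircuit_le)
  rw [SProg.Exec, hin, hout] at hruns
  have := outputsInTime_machine hruns
  have hmap : (DSym.encodeCircuit Γ).map M.inputAlphabet.symm = DSym.encodeCircuit Γ :=
    List.map_id _
  rw [hmap]
  exact this

end valuations

/-! ### Asymptotics and conclusion -/

open Real in
theorem timeBound_isBigO (q a h : ℕ) (hh : 1 ≤ h) : ∃ c : ℝ, 0 < c ∧
    (fun m : ℕ => ((SProg.timeBound q a (h - 1) (6 * m ^ 2) + 1 : ℕ) : ℝ)) =O[Filter.atTop]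
      (fun m : ℕ => (2 : ℝ) ^ (c * (logb 2 (m : ℝ)) ^ h)) := by
  obtain ⟨k, rfl⟩ := Nat.exists_eq_add_of_le' hh
  rw [Nat.add_sub_cancel]
  generalize hE : 300 * (k + 1) = E
  -- With `l = log₂ m ≥ 1` the word length is at most `2 ^ (5 * l)` and the budget `B` at most `a *
  -- 6 ^ k * l ^ k`. The exponent in `htotal` is `E + 22 * l + 2 * B + (7 + q) * l * B + 2`, and
  -- each of its terms is bounded by its coefficient times `l ^ (k + 1)`.
  refine ⟨E + 26 + (9 + q) * (a * 6 ^ k), by positivity, ?_⟩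
  refine Asymptotics.IsBigO.of_bound 1 (Filter.eventually_atTop.2 ⟨2, fun m hm => ?_⟩)
  rw [Real.norm_of_nonneg (Nat.cast_nonneg _), Real.norm_of_nonneg (Real.rpow_nonneg two_pos.le _),
    one_mul]
  have hm0 : (0 : ℝ) < m := by positivity
  set l := logb 2 (m : ℝ) with hl
  have hml : (2 : ℝ) ^ l = m := Real.rpow_logb two_pos (by norm_num) hm0
  have hl1 : 1 ≤ l := by
    rw [hl, Real.le_logb_iff_rpow_le one_lt_two hm0, Real.rpow_one]
    exact_mod_cast hm
  have le_two_rpow : ∀ n : ℕ, (n : ℝ) ≤ (2 : ℝ) ^ (n : ℝ) := by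
    intro n
    rw [Real.rpow_natCast]
    exact_mod_cast Nat.lt_two_pow_self.le
  have hn : ((6 * m ^ 2 : ℕ) : ℝ) ≤ (2 : ℝ) ^ (5 * l) := by
    have h₁ : (2 : ℝ) ^ (5 * l) = (m : ℝ) ^ 5 := by
      rw [mul_comm, Real.rpow_mul two_pos.le, hml]
      norm_cast
    have h₂ : 6 * m ^ 2 ≤ m ^ 5 := by
      calc 6 * m ^ 2 ≤ m ^ 3 * m ^ 2 := by
            refine Nat.mul_le_mul_right _ ?_
            calc 6 ≤ 2 ^ 3 := by norm_num
              _ ≤ m ^ 3 := Nat.pow_le_pow_left hm 3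
        _ = m ^ 5 := by ring
    rw [h₁]
    exact_mod_cast h₂
  have hsize : ((6 * m ^ 2).size : ℝ) ≤ 6 * l := by
    have h₁ : (6 * m ^ 2).size ≠ 0 := by
      have := Nat.size_pos.2 (show 0 < 6 * m ^ 2 by positivity)
      omega
    have h₂ : (2 : ℝ) ^ (((6 * m ^ 2).size - 1 : ℕ) : ℝ) ≤ 2 ^ (5 * l) := by
      refine le_trans ?_ hn
      rw [Real.rpow_natCast]
      exact_mod_cast Nat.lt_size.1 (Nat.sub_one_lt h₁)
    have h₃ := (Real.rpow_le_rpow_left_iff one_lt_two).1 h₂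
    rw [Nat.cast_pred (Nat.pos_of_ne_zero h₁)] at h₃
    linarith
  unfold SProg.timeBound
  generalize hB : a * (6 * m ^ 2).size ^ k = B
  have hBl : (B : ℝ) ≤ a * 6 ^ k * l ^ k := by
    rw [← hB, mul_assoc, ← mul_pow]
    push_cast
    gcongr
  generalize 6 * m ^ 2 = n at hn
  rw [hE]
  have hsum : ((n + B + 10 : ℕ) : ℝ) ≤ (2 : ℝ) ^ (11 * l + B) := by
    have h₁ : (2 : ℝ) ^ (5 * l) ≤ 2 ^ (5 * l + B) :=
      Real.rpow_le_rpow_of_exponent_le one_le_two (by linarith [(Nat.cast_nonneg B : (0 : ℝ) ≤ B)])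
    have h₂ : (B : ℝ) ≤ 2 ^ (5 * l + B) := (le_two_rpow B).trans
      (Real.rpow_le_rpow_of_exponent_le one_le_two (by linarith))
    have h₃ : (1 : ℝ) ≤ 2 ^ (5 * l + B) := Real.one_le_rpow one_le_two (by positivity)
    have h₄ : (2 : ℝ) ^ (11 * l + B) = 2 ^ (6 * l) * 2 ^ (5 * l + B) := by
      rw [← Real.rpow_add two_pos]; ring_nf
    have h₅ : (64 : ℝ) ≤ 2 ^ (6 * l) := by
      calc (64 : ℝ) = 2 ^ (6 : ℝ) := by norm_num
        _ ≤ _ := Real.rpow_le_rpow_of_exponent_le one_le_two (by linarith)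
    rw [h₄]
    push_cast
    nlinarith
  have hbase : ((n * (q + 1) + 1 : ℕ) : ℝ) ≤ (2 : ℝ) ^ ((7 + q) * l) := by
    have h₁ : (1 : ℝ) ≤ 2 ^ (5 * l) := Real.one_le_rpow one_le_two (by positivity)
    have h₂ : ((q + 2 : ℕ) : ℝ) ≤ 2 ^ ((q + 2) * l) := (le_two_rpow _).trans
      (Real.rpow_le_rpow_of_exponent_le one_le_two (by
        push_cast
        nlinarith [(Nat.cast_nonneg q : (0 : ℝ) ≤ q)]))
    calc ((n * (q + 1) + 1 : ℕ) : ℝ) ≤ 2 ^ (5 * l) * ((q + 2 : ℕ) : ℝ) := by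
          push_cast
          nlinarith [(Nat.cast_nonneg q : (0 : ℝ) ≤ q)]
      _ ≤ 2 ^ (5 * l) * 2 ^ ((q + 2) * l) := by gcongr
      _ = _ := by rw [← Real.rpow_add two_pos]; ring_nf
  have hpow : (((n * (q + 1) + 1) ^ B + 1 : ℕ) : ℝ) ≤ (2 : ℝ) ^ ((7 + q) * l * B + 1) := by
    have h₁ : ((n * (q + 1) + 1 : ℕ) : ℝ) ^ B ≤ (2 : ℝ) ^ ((7 + q) * l * B) := by
      rw [Real.rpow_mul two_pos.le, Real.rpow_natCast]
      gcongr
    have h₂ : (1 : ℝ) ≤ (2 : ℝ) ^ ((7 + q) * l * B) := Real.one_le_rpow one_le_two (by positivity)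
    rw [Real.rpow_add two_pos, Real.rpow_one]
    push_cast at h₁ ⊢
    linarith
  have htotal : ((E * (n + B + 10) ^ 2 * ((n * (q + 1) + 1) ^ B + 1) + 1 : ℕ) : ℝ) ≤
      2 ^ (E + 2 * (11 * l + B) + ((7 + q) * l * B + 1) + 1 : ℝ) := by
    have h₁ : ((E * (n + B + 10) ^ 2 * ((n * (q + 1) + 1) ^ B + 1) : ℕ) : ℝ) ≤
        2 ^ (E + 2 * (11 * l + B) + ((7 + q) * l * B + 1) : ℝ) := by
      rw [Real.rpow_add two_pos, Real.rpow_add two_pos, mul_comm 2, Real.rpow_mul two_pos.le]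
      rw [Nat.cast_mul, Nat.cast_mul, Nat.cast_pow]
      gcongr
      · exact le_two_rpow E
      · exact_mod_cast pow_le_pow_left₀ (Nat.cast_nonneg _) hsum 2
    have h₂ : (1 : ℝ) ≤ 2 ^ (E + 2 * (11 * l + B) + ((7 + q) * l * B + 1) : ℝ) :=
      Real.one_le_rpow one_le_two (by positivity)
    rw [Real.rpow_add two_pos _ 1, Real.rpow_one, Nat.cast_add, Nat.cast_one]
    linarith
  refine htotal.trans (Real.rpow_le_rpow_of_exponent_le one_le_two ?_)
  have hlk : 1 ≤ l ^ k := one_le_pow₀ hl1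
  have hl' : l ≤ l ^ (k + 1) := by rw [pow_succ]; nlinarith
  have hl'' : l ^ k ≤ l ^ (k + 1) := pow_le_pow_right₀ hl1 (by omega)
  have hone : 1 ≤ l ^ (k + 1) := hl1.trans hl'
  have hB' : (B : ℝ) ≤ a * 6 ^ k * l ^ (k + 1) := hBl.trans (by gcongr)
  have hlB : l * B ≤ a * 6 ^ k * l ^ (k + 1) := by
    calc l * B ≤ l * (a * 6 ^ k * l ^ k) := by gcongr
      _ = _ := by ring
  have hqlB : (7 + q) * (l * B) ≤ (7 + q) * (a * 6 ^ k * l ^ (k + 1)) := by gcongr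
  have hEl : (E : ℝ) * 1 ≤ E * l ^ (k + 1) := by gcongr
  nlinarith

theorem theorem1p2 (hSESH : SESH) (h : ℕ) (hh : 1 ≤ h) (p : Fin h → ℕ)
    (hp : AlternatingPrimes p) :
    (∃ c : ℝ, 0 < c ∧ ∃ T : ℕ → ℕ,
      DecidableInTime (DSym.encodeCircuit (p := p)) DCircuit.size DCircuit.CSat T ∧
      (fun m : ℕ => (T m : ℝ)) =O[Filter.atTop]
        (fun m : ℕ => (2 : ℝ) ^ (c * (Real.logb 2 (m : ℝ)) ^ h))) ∧
    (∃ c : ℝ, 0 < c ∧ ∃ T : ℕ → ℕ,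
      DecidableInTime (DSym.encodeCircuit (p := p)) DCircuit.size DCircuit.CEqv T ∧
      (fun m : ℕ => (T m : ℝ)) =O[Filter.atTop]
        (fun m : ℕ => (2 : ℝ) ^ (c * (Real.logb 2 (m : ℝ)) ^ h))) := by
  classical
  obtain ⟨A, hA⟩ := DCircuit.exists_sparse_solution hSESH hh hp
  obtain ⟨c, hc, hT⟩ := timeBound_isBigO (Nat.card (DAlg p)) A h hh
  have hsparse : ∀ (b : Bool) (Γ : DCircuit p),
      (∃ x, decide (Γ.value x Γ.out₁ = Γ.value x Γ.out₂) = b) →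
      ∃ x, decide (Γ.value x Γ.out₁ = Γ.value x Γ.out₂) = b ∧
        (Γ.support x).card ≤ A * Γ.size.size ^ (h - 1) := by
    rintro b Γ ⟨x, hx⟩
    -- The sparse valuation has the same difference of outputs as `x`, whether this is zero or not;
    -- so the bound serves satisfiability and the search for a counterexample to equivalence alike.
    obtain ⟨x', hx', hcard⟩ := hA Γ _ ⟨x, rfl⟩
    refine ⟨x', ?_, hcard⟩
    rw [← hx, decide_eq_decide, ← sub_eq_zero, hx', sub_eq_zero]
  refine ⟨⟨c, hc, _, decidableInTime_of_sparse hp.1 A (h - 1) true true (hsparse true) _ ?_, hT⟩,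
    ⟨c, hc, _, decidableInTime_of_sparse hp.1 A (h - 1) false false (hsparse false) _ ?_, hT⟩⟩
  · intro Γ
    simp [DCircuit.CSat]
  · intro Γ
    simp [DCircuit.CEqv]
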